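/- Let $L\ge 1$ and $n=2L$. Consider the complex channel $\mathbf y=\mathbf H\mathbf P\mathbf x+\mathbf n$ with $\mathbf H,\mathbf P\in\mathbb C^{n\times n}$ and $\mathbf n\sim\mathcal{CN}(\mathbf 0,\mathbf I)$. The $n$ symbols of $\mathbf x$ are independent and uniformly distributed on a constellation of $M$ distinct points of $\mathbb C$, and $\mathbb E[\mathbf x\mathbf x^H]=\mathbf I$; let $\mathbf x_1,\dots,\mathbf x_{M^{n}}$ be the possible inputs. The mutual information, in bits per channel use, is $$\mathcal I=\log_2 M-\frac{1}{2L\,M^{2L}}\sum_{m=1}^{M^{2L}}\mathbb E_{\mathbf n}\Big\{\log_2\sum_{k=1}^{M^{2L}}\exp\big[-\|\mathbf{HP}(\mathbf x_m-\mathbf x_k)+\mathbf n\|^2+\|\mathbf n\|^2\big]\Big\},$$ and the minimum mean square error (MMSE) matrix is $$\mathbf E=\mathbf I-\frac{1}{(\pi M)^{2L}}\int_{\mathbb C^{2L}}\frac{\big[\sum_{l}\mathbf x_l e^{-\|\mathbf y-\mathbf{HP}\mathbf x_l\|^2}\big]\big[\sum_{k}\mathbf x_k^H e^{-\|\mathbf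 y-\mathbf{HP}\mathbf x_k\|^2}\big]}{\sum_{m}e^{-\|\mathbf y-\mathbf{HP}\mathbf x_m\|^2}}\,d\mathbf y .$$ Let $\mathbf H=\mathbf U_{\mathbf H}\,\mathbf{Diag}(\boldsymbol\sigma)\,\mathbf V_{\mathbf H}^H$ be a singular value decomposition, with $\boldsymbol\sigma$ nonnegative and in decreasing order. Fix a unitary matrix $\mathbf V$ and take $\mathbf P=\mathbf V_{\mathbf H}\,\mathbf{Diag}(\sqrt{\boldsymbol\lambda})\,\mathbf V$. Regard $\mathcal I=\mathcal I(\boldsymbol\lambda)$ as a function of the power allocation vector $\boldsymbol\lambda$ on the orthant $\Lambda=\{\boldsymbol\lambda\in\mathbb R^{2L}:\lambda_i\ge 0 \text{ for all } i\}$; derivatives are taken within $\Lambda$ (so they are one-sided where some $\lambda_i=0$). Then: 1. $\mathcal I$ is concave on $\Lambda$. 2. $\mathcal I$ has a Hessian at every $\boldsymbol\lambda\in\Lambda$, and it is symmetric and negative semidefinite: $\mathcal H_{\boldsymbol\lambda}\mathcal I(\boldsymbol\lambda)\preceq\mathbf 0$. 3. $\mathcal I$ is differentiable at every $\boldsymbol\lambda\in\Lambda$,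 with gradient $$\nabla_{\boldsymbol\lambda}\mathcal I(\boldsymbol\lambda)=\frac{1}{2L\ln 2}\;\mathbf R\cdot\mathbf{vec}\big(\mathbf{Diag}^2(\boldsymbol\sigma)\,\mathbf V\mathbf E\mathbf V^H\big),$$ where $\mathbf{vec}$ stacks the columns of a matrix and $\mathbf R\in\mathbb R^{2L\times 4L^2}$ is the reduction matrix with $[\mathbf R]_{i,\,2L(j-1)+k}=1$ if $i=j=k$ and $0$ otherwise, for $i,j,k\in\{1,\dots,2L\}$. -/

import Mathlib

open MeasureTheory

noncomputable section

/-- Squared Euclidean norm `‖v‖²` of a complex vector. -/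
def sqNorm {n : ℕ} (v : Fin n → ℂ) : ℝ := ∑ i, ‖v i‖ ^ 2

/-- The law `𝒞𝒩(0, I)` of a circularly symmetric complex Gaussian vector with i.i.d. entries of
zero mean and unit variance: density `π⁻ⁿ exp (-‖z‖²)` with respect to Lebesgue measure. -/
def complexNoise (n : ℕ) : Measure (Fin n → ℂ) :=
  volume.withDensity fun z => ENNReal.ofReal (Real.exp (-sqNorm z) / Real.pi ^ n)

/-- The signal vector whose `i`-th symbol is the constellation point with label `m i`.
As `m` runs through all labellings, this enumerates the `M ^ n` possible inputs. -/
def signal {n M : ℕ} (c : Fin M → ℂ) (m : Fin n → Fin M) : Fin n → ℂ := fun i => c (m i)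

/-- The input, uniform on the `M ^ n` signal vectors, has unit covariance: `𝔼[x xᴴ] = I`. -/
def HasUnitCovariance (n : ℕ) {M : ℕ} (c : Fin M → ℂ) : Prop :=
  ((1 : ℂ) / (M : ℂ) ^ n) •
    ∑ m : Fin n → Fin M, Matrix.vecMulVec (signal c m) (star (signal c m)) =
      (1 : Matrix (Fin n) (Fin n) ℂ)

/-- The finite-alphabet mutual information, in bits per channel use, of `y = G x + n`, where
`G = H P`, the `n` symbols of `x` are independent and uniform on the `M`-point
constellation `c`, and the noise is `𝒞𝒩(0, I)`:
`log₂ M - 1 / (n Mⁿ) ∑ₘ 𝔼 log₂ ∑ₖ exp (-‖G (xₘ - xₖ) + n‖² + ‖n‖²)`. -/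
def mutualInfo {n M : ℕ} (c : Fin M → ℂ) (G : Matrix (Fin n) (Fin n) ℂ) : ℝ :=
  Real.logb 2 M - 1 / ((n : ℝ) * (M : ℝ) ^ n) *
    ∑ m : Fin n → Fin M, ∫ z, Real.logb 2 (∑ k : Fin n → Fin M,
      Real.exp (-sqNorm (G.mulVec (signal c m - signal c k) + z) + sqNorm z)) ∂(complexNoise n)

/-- The likelihood weight `exp (-‖y - G xₘ‖²)`. -/
def likelihood {n M : ℕ} (c : Fin M → ℂ) (G : Matrix (Fin n) (Fin n) ℂ)
    (y : Fin n → ℂ) (m : Fin n → Fin M) : ℝ :=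
  Real.exp (-sqNorm (y - G.mulVec (signal c m)))

/-- The minimum mean square error matrix (for unit-covariance inputs)
`I - (π M)⁻ⁿ ∫ [∑ₗ xₗ exp (-‖y - G xₗ‖²)] [∑ₖ xₖᴴ exp (-‖y - G xₖ‖²)] / ∑ₘ exp (-‖y - G xₘ‖²) dy`,
with the integral over `ℂⁿ` taken entrywise. -/
def mmseMatrix {n M : ℕ} (c : Fin M → ℂ) (G : Matrix (Fin n) (Fin n) ℂ) :
    Matrix (Fin n) (Fin n) ℂ :=
  1 - ((1 : ℂ) / ((Real.pi : ℂ) * (M : ℂ)) ^ n) • Matrix.of fun i j =>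
    ∫ y : Fin n → ℂ,
      (∑ l : Fin n → Fin M, signal c l i * (likelihood c G y l : ℂ)) *
        (∑ k : Fin n → Fin M, star (signal c k j) * (likelihood c G y k : ℂ)) /
          (∑ m : Fin n → Fin M, (likelihood c G y m : ℂ))

/-- The complex diagonal matrix `Diag (a)` of a real vector `a`. -/
def Diag {n : ℕ} (a : Fin n → ℝ) : Matrix (Fin n) (Fin n) ℂ :=
  Matrix.diagonal fun i => (a i : ℂ)

/-- The precoder `P = U Diag (√λ) V`. -/
def precoder {n : ℕ} (U V : Matrix (Fin n) (Fin n) ℂ) (lam : Fin n → ℝ) :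
    Matrix (Fin n) (Fin n) ℂ :=
  U * Diag (fun i => Real.sqrt (lam i)) * V

/-- The `n × n²` reduction matrix. Its columns are indexed by pairs `(j, k)`, standing for the
position `n (j - 1) + k`, as are the entries of `Matrix.vec` (`j` the column and `k` the row of
the vectorized matrix). -/
def reductionMatrix (n : ℕ) : Matrix (Fin n) (Fin n × Fin n) ℝ :=
  Matrix.of fun i jk => if i = jk.1 ∧ jk.1 = jk.2 then 1 else 0

/-- The power allocation vectors: those with nonnegative entries. -/
def powerVectors (n : ℕ) : Set (EuclideanSpace ℝ (Fin n)) := {lam | ∀ i, 0 ≤ lam i}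

/-- The mutual information as a function of the power allocation vector, for the channel `H` and
the precoder `U Diag (√λ) V` with `U` and `V` fixed. -/
def powerMutualInfo {n M : ℕ} (c : Fin M → ℂ) (H U V : Matrix (Fin n) (Fin n) ℂ)
    (lam : EuclideanSpace ℝ (Fin n)) : ℝ :=
  mutualInfo c (H * precoder U V lam)

/-- `A` is the Hessian matrix of `f` at `x` within `s`: the gradient of `f` within `s` is
differentiable at `x` within `s`, with derivative `v ↦ A v`. -/
def HasHessianWithinAt {n : ℕ} (f : EuclideanSpace ℝ (Fin n) → ℝ)
    (A : Matrix (Fin n) (Fin n) ℝ) (s : Set (EuclideanSpace ℝ (Fin n)))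
    (x : EuclideanSpace ℝ (Fin n)) : Prop :=
  HasFDerivWithinAt (gradientWithin f s) (Matrix.toEuclideanCLM (𝕜 := ℝ) A) s x

end

/-! The unitary factor `UH` does not change the law of the noise, and `VH` cancels against the
precoder. What remains is a family of fixed signals `a m = Diag σ * V x_m` whose entries are scaled
by `√λᵢ`.

Take pure noise `z` as the reference law of the output and put `u = √λ z` entrywise. The likelihood
ratio of the signal `a k` is then `exp (l k)`, with `l k = ∑ᵢ 2 Re (conj (aₖᵢ) uᵢ) - λᵢ |aₖᵢ|²`
linear in the pair `(λ, u)`. With `Q = ∑ₖ exp (l k)`, a change of measure (`sum_integral_log_eq`)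
expresses the mutual information as a constant minus a nonnegative multiple of `𝔼[Q log Q] - ∑ᵢ λᵢ
∑ₘ |aₘᵢ|²`.

Under the reference law `uᵢ` is Gaussian of variance `λᵢ`. By Stein's identity
(`hasFDerivAt_gaussMean`), differentiating a mean in `λᵢ` applies `∂/∂λᵢ + ¼ Δᵢ` to the integrand,
where `Δᵢ` is the Laplacian in `uᵢ`. This operator kills every `exp (l k)`, hence also `Q` and every
sum `N = ∑ₖ fₖ exp (l k)`. Only the second-order chain rule terms survive: `Q log Q` gives the
energies `N² / Q` with `f` the real and imaginary parts of `aₖᵢ`, and these in turn give `2 Q Cov²`,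
with covariances under the Gibbs weights `exp (l k) / Q`. The matrix of squared covariances is
positive semidefinite, as in the Schur product theorem. This gives the sign of the Hessian, and
concavity follows along segments.

The mean energy is, up to normalization, the second moment of the conditional mean of the signal, so
unit covariance turns the gradient into the diagonal of `Diag σ ^ 2 * V * E * Vᴴ`. On the walls `λᵢ
= 0`, where `√λᵢ` is not differentiable, the formulas persist because all the means are continuous
up to the boundary (`hasFDerivWithinAt_powerVectors`). -/

/-! ### Complex Gaussian noise: density, integrability and shifts. -/

theorem continuous_sqNorm (n : ℕ) : Continuous (sqNorm : (Fin n → ℂ) → ℝ) := by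
  unfold sqNorm; fun_prop

theorem sqNorm_nonneg {n : ℕ} (z : Fin n → ℂ) : 0 ≤ sqNorm z :=
  Finset.sum_nonneg fun _ _ => by positivity

theorem norm_sq_le_sqNorm {n : ℕ} (z : Fin n → ℂ) : ‖z‖ ^ 2 ≤ sqNorm z := by
  have h : ‖z‖ ≤ Real.sqrt (sqNorm z) := by
    refine (pi_norm_le_iff_of_nonneg (Real.sqrt_nonneg _)).2 fun i => ?_
    refine Real.le_sqrt_of_sq_le ?_
    exact Finset.single_le_sum (f := fun i => ‖z i‖ ^ 2) (fun _ _ => by positivity)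
      (Finset.mem_univ i)
  calc ‖z‖ ^ 2 ≤ Real.sqrt (sqNorm z) ^ 2 := by gcongr
    _ = sqNorm z := Real.sq_sqrt (sqNorm_nonneg z)

theorem sqNorm_neg {n : ℕ} (z : Fin n → ℂ) : sqNorm (-z) = sqNorm z := by
  simp [sqNorm]

/-- The density of `complexNoise`. -/
noncomputable def noiseDensity {n : ℕ} (z : Fin n → ℂ) : ℝ := Real.exp (-sqNorm z) / Real.pi ^ n

theorem noiseDensity_nonneg {n : ℕ} (z : Fin n → ℂ) : 0 ≤ noiseDensity z := by
  unfold noiseDensity; positivity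

theorem continuous_noiseDensity (n : ℕ) : Continuous (noiseDensity : (Fin n → ℂ) → ℝ) := by
  unfold noiseDensity
  have := continuous_sqNorm n
  fun_prop

theorem integral_complexNoise {n : ℕ} {F : Type*} [NormedAddCommGroup F] [NormedSpace ℝ F]
    (f : (Fin n → ℂ) → F) :
    ∫ z, f z ∂complexNoise n = ∫ z, noiseDensity z • f z := by
  unfold complexNoise
  rw [integral_withDensity_eq_integral_toReal_smul]
  · refine integral_congr_ae (.of_forall fun z => ?_)
    change (ENNReal.ofReal (noiseDensity z)).toReal • f z = _
    rw [ENNReal.toReal_ofReal (noiseDensity_nonneg z)]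
  · exact (continuous_noiseDensity n).measurable.ennreal_ofReal
  · exact .of_forall fun _ => ENNReal.ofReal_lt_top

theorem integrable_complexNoise_iff {n : ℕ} {F : Type*} [NormedAddCommGroup F] [NormedSpace ℝ F]
    (f : (Fin n → ℂ) → F) :
    Integrable f (complexNoise n) ↔ Integrable fun z => noiseDensity z • f z := by
  unfold complexNoise
  rw [integrable_withDensity_iff_integrable_smul']
  · refine integrable_congr (.of_forall fun z => ?_)
    change (ENNReal.ofReal (noiseDensity z)).toReal • f z = _
    rw [ENNReal.toReal_ofReal (noiseDensity_nonneg z)]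
  · exact (continuous_noiseDensity n).measurable.ennreal_ofReal
  · exact .of_forall fun _ => ENNReal.ofReal_lt_top

theorem integrable_exp_neg_mul_sqNorm (n : ℕ) {b : ℝ} (hb : 0 < b) :
    Integrable fun z : Fin n → ℂ => Real.exp (-b * sqNorm z) := by
  have h1 : Integrable fun z : ℂ => Real.exp (-b * ‖z‖ ^ 2) := by
    have := GaussianFourier.integrable_cexp_neg_mul_sq_norm_add (V := ℂ) (b := (b : ℂ))
      (by simpa using hb) 0 0
    refine this.norm.congr (.of_forall fun z => ?_)
    simp only [Complex.norm_exp]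
    congr 1
    have : (-(b : ℂ) * (‖z‖ : ℂ) ^ 2 + 0 * ((inner ℝ (0 : ℂ) z : ℝ) : ℂ))
        = ((-b * ‖z‖ ^ 2 : ℝ) : ℂ) := by
      push_cast; ring
    rw [this, Complex.ofReal_re]
  have h2 := Integrable.fintype_prod (ι := Fin n) (f := fun _ (z : ℂ) => Real.exp (-b * ‖z‖ ^ 2))
    (μ := fun _ => volume) fun _ => h1
  refine h2.congr (.of_forall fun z => ?_)
  simp only [sqNorm, Finset.mul_sum, Real.exp_sum]

/-- Source of all integrability below: every dominating function used under the noise is reduced to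
this one. -/
theorem integrable_exp_mul_norm (n : ℕ) (C : ℝ) :
    Integrable (fun z : Fin n → ℂ => Real.exp (C * ‖z‖)) (complexNoise n) := by
  rw [integrable_complexNoise_iff]
  refine ((integrable_exp_neg_mul_sqNorm n (b := 1 / 2) (by norm_num)).const_mul
    (Real.exp (C ^ 2 / 2) / Real.pi ^ n)).mono' ?_ (.of_forall fun z => ?_)
  · have := continuous_noiseDensity n
    exact Continuous.aestronglyMeasurable (by fun_prop)
  · have h0 : 0 ≤ noiseDensity z := noiseDensity_nonneg z
    rw [norm_smul, Real.norm_of_nonneg h0, Real.norm_of_nonneg (Real.exp_nonneg _)]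
    unfold noiseDensity
    rw [div_mul_eq_mul_div, div_mul_eq_mul_div, ← Real.exp_add, ← Real.exp_add]
    refine div_le_div_of_nonneg_right (Real.exp_le_exp.2 ?_) (by positivity)
    -- `C ‖z‖ ≤ C² / 2 + ‖z‖² / 2`, so half of the Gaussian exponent absorbs the growth and the
    -- other half remains.
    nlinarith [norm_sq_le_sqNorm z, sq_nonneg (C - ‖z‖)]

theorem integral_exp_neg_sqNorm (n : ℕ) :
    ∫ z : Fin n → ℂ, Real.exp (-sqNorm z) = Real.pi ^ n := by
  have h1 : ∫ z : ℂ, Real.exp (-‖z‖ ^ 2) = Real.pi := by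
    have := GaussianFourier.integral_rexp_neg_mul_sq_norm (V := ℂ) (b := 1) one_pos
    simpa [Complex.finrank_real_complex] using this
  have h2 := integral_fintype_prod_volume_eq_pow (ι := Fin n)
    (fun z : ℂ => Real.exp (-‖z‖ ^ 2))
  rw [h1, Fintype.card_fin] at h2
  rw [← h2]
  refine integral_congr_ae (.of_forall fun z => ?_)
  simp only [sqNorm, ← Real.exp_sum, Finset.sum_neg_distrib]

theorem integral_noiseDensity (n : ℕ) : ∫ z : Fin n → ℂ, noiseDensity z = 1 := by
  unfold noiseDensity
  rw [integral_div, integral_exp_neg_sqNorm, div_self (by positivity)]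

theorem integral_const_complexNoise (n : ℕ) (a : ℝ) : ∫ _, a ∂complexNoise n = a := by
  rw [integral_complexNoise]
  simp only [smul_eq_mul]
  rw [integral_mul_const, integral_noiseDensity, one_mul]

/-- Cameron–Martin formula for a shift of the noise. -/
theorem integral_complexNoise_shift {n : ℕ} (b : Fin n → ℂ) (f : (Fin n → ℂ) → ℝ) :
    ∫ z, f (z + b) ∂complexNoise n =
      ∫ z, Real.exp (-sqNorm (z - b) + sqNorm z) * f z ∂complexNoise n := by
  rw [integral_complexNoise, integral_complexNoise, ← integral_add_right_eq_self
    (fun z => noiseDensity z • (Real.exp (-sqNorm (z - b) + sqNorm z) * f z)) b]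
  refine integral_congr_ae (.of_forall fun z => ?_)
  simp only [smul_eq_mul, noiseDensity, add_sub_cancel_right]
  rw [← mul_assoc, div_mul_eq_mul_div (Real.exp _) _ (Real.exp _), ← Real.exp_add]
  congr 3
  ring

theorem integral_complexNoise_odd {n : ℕ} (f : (Fin n → ℂ) → ℝ) (hf : ∀ z, f (-z) = -f z) :
    ∫ z, f z ∂complexNoise n = 0 := by
  rw [integral_complexNoise]
  have h := integral_neg_eq_self (fun z : Fin n → ℂ => noiseDensity z • f z) volume
  have h2 : (fun z : Fin n → ℂ => noiseDensity (-z) • f (-z)) =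
      fun z => -(noiseDensity z • f z) := by
    funext z
    simp [noiseDensity, sqNorm_neg, hf]
  rw [h2, integral_neg] at h
  linarith

/-! ### Unitary invariance. -/

/-- A unitary matrix preserves Lebesgue measure on `ℂⁿ`. -/
theorem measurePreserving_unitary {n : ℕ} {U : Matrix (Fin n) (Fin n) ℂ}
    (hU : U ∈ Matrix.unitaryGroup (Fin n) ℂ) :
    MeasurePreserving (fun z : Fin n → ℂ => U.mulVec z) volume volume := by
  have hdet : ‖U.det‖ = 1 := by
    have := Matrix.det_of_mem_unitary hU
    exact CStarRing.norm_of_mem_unitary this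
  set f : (Fin n → ℂ) →ₗ[ℝ] (Fin n → ℂ) := (Matrix.mulVecLin U).restrictScalars ℝ with hf
  -- The real determinant of a complex linear map is the squared modulus of its complex determinant.
  have hdf : LinearMap.det f = 1 := by
    rw [hf, LinearMap.det_restrictScalars, ← Matrix.toLin'_apply', LinearMap.det_toLin',
      Algebra.norm_complex_apply, Complex.normSq_eq_norm_sq, hdet, one_pow]
  have hmap := Measure.map_linearMap_addHaar_eq_smul_addHaar
    (volume : Measure (Fin n → ℂ)) (f := f) (by rw [hdf]; exact one_ne_zero)
  refine ⟨?_, ?_⟩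
  · exact (LinearMap.continuous_of_finiteDimensional f).measurable
  · have : (fun z : Fin n → ℂ => U.mulVec z) = f := by
      funext z; simp [hf]
    rw [this, hmap, hdf]
    simp

theorem sqNorm_mulVec_unitary {n : ℕ} {U : Matrix (Fin n) (Fin n) ℂ}
    (hU : U ∈ Matrix.unitaryGroup (Fin n) ℂ) (z : Fin n → ℂ) :
    sqNorm (U.mulVec z) = sqNorm z := by
  have key : ∀ v : Fin n → ℂ, ((sqNorm v : ℝ) : ℂ) = star v ⬝ᵥ v := by
    intro v
    simp only [sqNorm, dotProduct, Pi.star_apply, Complex.star_def, Complex.conj_mul']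
    push_cast
    rfl
  apply Complex.ofReal_injective
  rw [key, key, Matrix.star_mulVec, Matrix.dotProduct_mulVec, Matrix.vecMul_vecMul,
    ← Matrix.star_eq_conjTranspose, (Matrix.mem_unitaryGroup_iff'.1 hU), Matrix.vecMul_one]

theorem measurableEmbedding_unitary {n : ℕ} {U : Matrix (Fin n) (Fin n) ℂ}
    (hU : U ∈ Matrix.unitaryGroup (Fin n) ℂ) :
    MeasurableEmbedding (fun z : Fin n → ℂ => U.mulVec z) := by
  refine (Continuous.measurableEmbedding ?_ ?_)
  · fun_prop
  · intro x y hxy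
    have h := congrArg (fun z => (star U).mulVec z) hxy
    simpa [Matrix.mulVec_mulVec, Matrix.mem_unitaryGroup_iff'.1 hU] using h

theorem integral_comp_unitary {n : ℕ} {U : Matrix (Fin n) (Fin n) ℂ}
    (hU : U ∈ Matrix.unitaryGroup (Fin n) ℂ) {F : Type*} [NormedAddCommGroup F] [NormedSpace ℝ F]
    (f : (Fin n → ℂ) → F) :
    ∫ z, f (U.mulVec z) = ∫ z, f z :=
  (measurePreserving_unitary hU).integral_comp (measurableEmbedding_unitary hU) f

theorem integral_complexNoise_comp_unitary {n : ℕ} {U : Matrix (Fin n) (Fin n) ℂ}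
    (hU : U ∈ Matrix.unitaryGroup (Fin n) ℂ) {F : Type*} [NormedAddCommGroup F] [NormedSpace ℝ F]
    (f : (Fin n → ℂ) → F) :
    ∫ z, f (U.mulVec z) ∂complexNoise n = ∫ z, f z ∂complexNoise n := by
  rw [integral_complexNoise, integral_complexNoise,
    ← integral_comp_unitary hU fun z => noiseDensity z • f z]
  simp only [noiseDensity, sqNorm_mulVec_unitary hU]

/-! ### Real coordinates on `ℂⁿ` and integration by parts -/

/-- The real coordinate `Re z i` or `Im z i`. -/
noncomputable def coord {n : ℕ} (κ : Fin n × Bool) : (Fin n → ℂ) →L[ℝ] ℝ :=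
  (if κ.2 then Complex.reCLM else Complex.imCLM) ∘L ContinuousLinearMap.proj κ.1

/-- The unit vector along a real coordinate. -/
noncomputable def coordVec {n : ℕ} (κ : Fin n × Bool) : Fin n → ℂ :=
  Pi.single κ.1 (if κ.2 then 1 else Complex.I)

theorem coord_true {n : ℕ} (i : Fin n) (z : Fin n → ℂ) : coord (i, true) z = (z i).re := by
  simp [coord]

theorem coord_false {n : ℕ} (i : Fin n) (z : Fin n → ℂ) : coord (i, false) z = (z i).im := by
  simp [coord]

theorem coord_coordVec {n : ℕ} (κ μ : Fin n × Bool) :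
    coord κ (coordVec μ) = if κ = μ then 1 else 0 := by
  obtain ⟨i, a⟩ := κ
  obtain ⟨j, b⟩ := μ
  by_cases h : i = j
  · subst h
    cases a <;> cases b <;> simp [coord, coordVec]
  · cases a <;> cases b <;> simp [coord, coordVec, h]

theorem abs_coord_le {n : ℕ} (κ : Fin n × Bool) (z : Fin n → ℂ) : |coord κ z| ≤ ‖z‖ := by
  obtain ⟨i, b⟩ := κ
  cases b
  · rw [coord_false]; exact (Complex.abs_im_le_norm _).trans (norm_le_pi_norm z i)
  · rw [coord_true]; exact (Complex.abs_re_le_norm _).trans (norm_le_pi_norm z i)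

theorem sum_coord_smul {n : ℕ} (i : Fin n) (z : Fin n → ℂ) :
    ∑ b, coord (i, b) z • coordVec (i, b) = Pi.single i (z i) := by
  rw [Fintype.sum_bool, coord_true, coord_false]
  ext j
  by_cases h : j = i
  · subst h
    simp [coordVec]
  · simp [coordVec, h]

theorem sum_coord_sq {n : ℕ} (i : Fin n) (z : Fin n → ℂ) :
    ∑ b, coord (i, b) z ^ 2 = ‖z i‖ ^ 2 := by
  rw [Fintype.sum_bool, coord_true, coord_false, ← Complex.normSq_eq_norm_sq, Complex.normSq_apply]
  ring

theorem sqNorm_eq_sum_coord {n : ℕ} (z : Fin n → ℂ) : sqNorm z = ∑ κ, coord κ z ^ 2 := by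
  rw [Fintype.sum_prod_type]
  exact Finset.sum_congr rfl fun i _ => (sum_coord_sq i z).symm

theorem sqNorm_add_smul_coordVec {n : ℕ} (κ : Fin n × Bool) (z : Fin n → ℂ) (t : ℝ) :
    sqNorm (z + t • coordVec κ) = sqNorm z + 2 * t * coord κ z + t ^ 2 := by
  simp only [sqNorm_eq_sum_coord, map_add, map_smul, coord_coordVec, smul_eq_mul, add_sq,
    Finset.sum_add_distrib, mul_pow]
  simp [Finset.sum_ite_eq']
  ring

/-- Each real coordinate has variance `1 / 2`; the factor `2` here becomes the `1 / 2` of Stein's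
identity and the `1 / 4` in front of the Laplacian. -/
theorem hasLineDerivAt_noiseDensity {n : ℕ} (κ : Fin n × Bool) (z : Fin n → ℂ) :
    HasLineDerivAt ℝ noiseDensity (-(2 * coord κ z) * noiseDensity z) z (coordVec κ) := by
  unfold HasLineDerivAt noiseDensity
  simp only [sqNorm_add_smul_coordVec]
  have h : HasDerivAt (fun t : ℝ => -(sqNorm z + 2 * t * coord κ z + t ^ 2))
      (-(2 * coord κ z)) 0 := by
    have h1 := ((((hasDerivAt_id (0 : ℝ)).const_mul 2).mul_const (coord κ z)).const_add
      (sqNorm z)).add (hasDerivAt_pow 2 (0 : ℝ))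
    exact h1.neg.congr_deriv (by simp)
  convert! (h.exp.div_const (Real.pi ^ n)) using 1
  simp
  ring

/-- Stein's identity for the standard complex Gaussian noise. -/
theorem integral_coord_mul_complexNoise {n : ℕ} (κ : Fin n × Bool) {g g' : (Fin n → ℂ) → ℝ}
    (hg : Integrable g (complexNoise n)) (hg' : Integrable g' (complexNoise n))
    (hcg : Integrable (fun z => coord κ z * g z) (complexNoise n))
    (hd : ∀ z, HasLineDerivAt ℝ g (g' z) z (coordVec κ)) :
    ∫ z, coord κ z * g z ∂complexNoise n = 1 / 2 * ∫ z, g' z ∂complexNoise n := by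
  rw [integrable_complexNoise_iff] at hg hg' hcg
  have h := integral_bilinear_hasLineDerivAt_right_eq_neg_left_of_integrable
    (μ := (volume : Measure (Fin n → ℂ))) (B := ContinuousLinearMap.mul ℝ ℝ)
    (f := noiseDensity) (f' := fun z => -(2 * coord κ z) * noiseDensity z) (g := g) (g' := g')
    (v := coordVec κ)
    ((hcg.const_mul (-2)).congr (.of_forall fun z => by simp; ring)) hg' hg
    (fun z _ => hasLineDerivAt_noiseDensity κ z) (fun z _ => hd z)
  simp only [ContinuousLinearMap.mul_apply'] at h
  rw [integral_complexNoise, integral_complexNoise]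
  simp only [smul_eq_mul]
  rw [h, ← integral_neg, ← integral_const_mul]
  refine integral_congr_ae (.of_forall fun z => ?_)
  simp only
  ring

/-! ### Functions of exponential growth -/

/-- A continuous function bounded by `C * exp (C * ‖w‖)`. -/
def ExpGrowth {W : Type*} [NormedAddCommGroup W] (g : W → ℝ) : Prop :=
  Continuous g ∧ ∃ C, ∀ w, |g w| ≤ C * Real.exp (C * ‖w‖)

namespace ExpGrowth

variable {W : Type*} [NormedAddCommGroup W] {f g : W → ℝ}

theorem exists_pos_bound (hf : ExpGrowth f) :
    ∃ C, 0 ≤ C ∧ ∀ w, |f w| ≤ C * Real.exp (C * ‖w‖) := by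
  obtain ⟨-, C, hC⟩ := hf
  refine ⟨C, ?_, hC⟩
  have := (abs_nonneg _).trans (hC 0)
  simpa using this

theorem of_bound {C D : ℝ} (hc : Continuous f) (h : ∀ w, |f w| ≤ C * Real.exp (D * ‖w‖)) :
    ExpGrowth f := by
  refine ⟨hc, max C D, fun w => (h w).trans ?_⟩
  have h0 : 0 ≤ C := by simpa using (abs_nonneg _).trans (h 0)
  gcongr
  · exact le_max_left _ _
  · exact le_max_right _ _

theorem add (hf : ExpGrowth f) (hg : ExpGrowth g) : ExpGrowth fun w => f w + g w := by
  obtain ⟨C, hC0, hC⟩ := hf.exists_pos_bound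
  obtain ⟨D, hD0, hD⟩ := hg.exists_pos_bound
  refine of_bound (C := C + D) (D := max C D) (hf.1.add hg.1) fun w => ?_
  calc |f w + g w| ≤ |f w| + |g w| := abs_add_le _ _
    _ ≤ C * Real.exp (C * ‖w‖) + D * Real.exp (D * ‖w‖) := add_le_add (hC w) (hD w)
    _ ≤ C * Real.exp (max C D * ‖w‖) + D * Real.exp (max C D * ‖w‖) := by
        gcongr
        · exact le_max_left _ _
        · exact le_max_right _ _
    _ = _ := by ring

theorem mul (hf : ExpGrowth f) (hg : ExpGrowth g) : ExpGrowth fun w => f w * g w := by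
  obtain ⟨C, hC0, hC⟩ := hf.exists_pos_bound
  obtain ⟨D, hD0, hD⟩ := hg.exists_pos_bound
  refine of_bound (C := C * D) (D := C + D) (hf.1.mul hg.1) fun w => ?_
  rw [abs_mul]
  calc |f w| * |g w| ≤ (C * Real.exp (C * ‖w‖)) * (D * Real.exp (D * ‖w‖)) :=
        mul_le_mul (hC w) (hD w) (abs_nonneg _) (by positivity)
    _ = C * D * Real.exp ((C + D) * ‖w‖) := by rw [add_mul, Real.exp_add]; ring

theorem of_bounded {C : ℝ} (hc : Continuous f) (h : ∀ w, |f w| ≤ C) : ExpGrowth f :=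
  of_bound (C := C) (D := 0) hc (by simpa using h)

theorem const (a : ℝ) : ExpGrowth fun _ : W => a :=
  of_bounded continuous_const fun _ => le_rfl

theorem const_mul (a : ℝ) (hf : ExpGrowth f) : ExpGrowth fun w => a * f w := (const a).mul hf

theorem neg (hf : ExpGrowth f) : ExpGrowth fun w => -f w := by
  simpa using hf.const_mul (-1)

theorem sub (hf : ExpGrowth f) (hg : ExpGrowth g) : ExpGrowth fun w => f w - g w := by
  simpa [sub_eq_add_neg] using hf.add hg.neg

theorem pow (hf : ExpGrowth f) (k : ℕ) : ExpGrowth fun w => f w ^ k := by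
  induction k with
  | zero => simpa using const 1
  | succ k ih => simpa [pow_succ] using ih.mul hf

theorem sum {ι : Type*} (s : Finset ι) {f : ι → W → ℝ} (hf : ∀ i ∈ s, ExpGrowth (f i)) :
    ExpGrowth fun w => ∑ i ∈ s, f i w := by
  classical
  induction s using Finset.induction_on with
  | empty => simpa using const 0
  | insert i s his ih =>
    simp only [Finset.sum_insert his]
    exact (hf i (Finset.mem_insert_self _ _)).add
      (ih fun j hj => hf j (Finset.mem_insert_of_mem hj))

variable [NormedSpace ℝ W]

theorem clm (l : W →L[ℝ] ℝ) : ExpGrowth l := by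
  refine of_bound (C := ‖l‖) (D := 1) l.continuous fun w => (l.le_opNorm w).trans ?_
  gcongr
  rw [one_mul]
  linarith [Real.add_one_le_exp ‖w‖]

theorem exp_clm (l : W →L[ℝ] ℝ) : ExpGrowth fun w => Real.exp (l w) := by
  refine of_bound (C := 1) (D := ‖l‖) (Real.continuous_exp.comp l.continuous) fun w => ?_
  rw [abs_of_pos (Real.exp_pos _), one_mul]
  exact Real.exp_le_exp.2 ((le_abs_self _).trans (l.le_opNorm w))

end ExpGrowth

/-! ### Gaussian means with coordinatewise variances -/

/-- The vector with entries `√(r i) * z i`. -/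
noncomputable def scaleNoise {n : ℕ} (r : EuclideanSpace ℝ (Fin n)) (z : Fin n → ℂ) : Fin n → ℂ :=
  fun i => ((Real.sqrt (r i) : ℝ) : ℂ) * z i

/-- The mean of `Ψ (r, u)` over `u` Gaussian with entries of variance `r i`. -/
noncomputable def gaussMean {n : ℕ} (Ψ : EuclideanSpace ℝ (Fin n) × (Fin n → ℂ) → ℝ)
    (r : EuclideanSpace ℝ (Fin n)) : ℝ :=
  ∫ z, Ψ (r, scaleNoise r z) ∂complexNoise n

/-- The unit vector along the `i`-th variance. -/
noncomputable def varDir {n : ℕ} (i : Fin n) : EuclideanSpace ℝ (Fin n) × (Fin n → ℂ) :=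
  (EuclideanSpace.single i 1, 0)

/-- The unit vector along a real coordinate of the field. -/
noncomputable def fieldDir {n : ℕ} (κ : Fin n × Bool) :
    EuclideanSpace ℝ (Fin n) × (Fin n → ℂ) :=
  (0, coordVec κ)

theorem continuous_scaleNoise (n : ℕ) :
    Continuous fun p : EuclideanSpace ℝ (Fin n) × (Fin n → ℂ) => (p.1, scaleNoise p.1 p.2) := by
  unfold scaleNoise
  fun_prop

theorem continuous_scaleNoise_right {n : ℕ} (r : EuclideanSpace ℝ (Fin n)) :
    Continuous fun z : Fin n → ℂ => (r, scaleNoise r z) :=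
  (continuous_scaleNoise n).comp (by fun_prop : Continuous fun z : Fin n → ℂ => (r, z))

theorem continuous_scaleNoise_left {n : ℕ} (z : Fin n → ℂ) :
    Continuous fun r : EuclideanSpace ℝ (Fin n) => (r, scaleNoise r z) :=
  (continuous_scaleNoise n).comp
    (by fun_prop : Continuous fun r : EuclideanSpace ℝ (Fin n) => (r, z))

theorem norm_scaleNoise_le {n : ℕ} (r : EuclideanSpace ℝ (Fin n)) (z : Fin n → ℂ) :
    ‖(r, scaleNoise r z)‖ ≤ ‖r‖ + Real.sqrt ‖r‖ * ‖z‖ := by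
  have h : ‖scaleNoise r z‖ ≤ Real.sqrt ‖r‖ * ‖z‖ := by
    refine (pi_norm_le_iff_of_nonneg (by positivity)).2 fun i => ?_
    unfold scaleNoise
    rw [norm_mul, Complex.norm_real, Real.norm_of_nonneg (Real.sqrt_nonneg _)]
    gcongr
    · exact (le_abs_self _).trans (PiLp.norm_apply_le r i)
    · exact norm_le_pi_norm z i
  rw [Prod.norm_def]
  refine max_le ?_ ?_
  · have : 0 ≤ Real.sqrt ‖r‖ * ‖z‖ := by positivity
    linarith
  · linarith [norm_nonneg r]

/-- The bound is uniform for `r` in a ball, which supplies the dominating functions for continuity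
and differentiation in `r`. -/
theorem ExpGrowth.exists_scaleNoise_bound {n : ℕ}
    {Ψ : EuclideanSpace ℝ (Fin n) × (Fin n → ℂ) → ℝ} (h : ExpGrowth Ψ) (R : ℝ) :
    ∃ D, ∀ r : EuclideanSpace ℝ (Fin n), ‖r‖ ≤ R → ∀ z,
      |Ψ (r, scaleNoise r z)| ≤ D * Real.exp (D * ‖z‖) := by
  obtain ⟨C, hC0, hC⟩ := h.exists_pos_bound
  refine ⟨max (C * Real.exp (C * R)) (C * Real.sqrt R), fun r hr z => (hC _).trans ?_⟩
  have hR : 0 ≤ R := (norm_nonneg r).trans hr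
  calc C * Real.exp (C * ‖(r, scaleNoise r z)‖)
      ≤ C * Real.exp (C * (R + Real.sqrt R * ‖z‖)) := by
        gcongr
        refine (norm_scaleNoise_le r z).trans ?_
        gcongr
    _ = C * Real.exp (C * R) * Real.exp (C * Real.sqrt R * ‖z‖) := by
        rw [mul_add, Real.exp_add]; ring_nf
    _ ≤ _ := by
        gcongr
        · exact le_max_left _ _
        · exact le_max_right _ _

theorem ExpGrowth.integrable_scaleNoise {n : ℕ}
    {Ψ : EuclideanSpace ℝ (Fin n) × (Fin n → ℂ) → ℝ} (h : ExpGrowth Ψ)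
    (r : EuclideanSpace ℝ (Fin n)) :
    Integrable (fun z => Ψ (r, scaleNoise r z)) (complexNoise n) := by
  obtain ⟨D, hD⟩ := h.exists_scaleNoise_bound ‖r‖
  exact ((integrable_exp_mul_norm n D).const_mul D).mono'
    (h.1.comp (continuous_scaleNoise_right r)).aestronglyMeasurable
    (.of_forall fun z => hD r le_rfl z)

/-- Continuity holds on the whole space, walls included, because `Real.sqrt` is continuous
everywhere and vanishes on negative reals. The extension to the closed orthant rests on it. -/
theorem ExpGrowth.continuous_gaussMean {n : ℕ}
    {Ψ : EuclideanSpace ℝ (Fin n) × (Fin n → ℂ) → ℝ} (h : ExpGrowth Ψ) :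
    Continuous (gaussMean Ψ) := by
  rw [continuous_iff_continuousAt]
  intro r
  obtain ⟨D, hD⟩ := h.exists_scaleNoise_bound (‖r‖ + 1)
  refine continuousAt_of_dominated (bound := fun z => D * Real.exp (D * ‖z‖)) ?_ ?_
    ((integrable_exp_mul_norm n D).const_mul D) ?_
  · exact .of_forall fun r' => (h.1.comp (continuous_scaleNoise_right r')).aestronglyMeasurable
  · have : ∀ᶠ r' in nhds r, ‖r'‖ < ‖r‖ + 1 :=
      (continuous_norm.tendsto r).eventually (gt_mem_nhds (lt_add_one _))
    filter_upwards [this] with r' hr'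
    exact .of_forall fun z => hD r' hr'.le z
  · exact .of_forall fun z => (h.1.comp (continuous_scaleNoise_left z)).continuousAt

theorem clm_eq_sum_proj {n : ℕ} (l : EuclideanSpace ℝ (Fin n) →L[ℝ] ℝ) :
    l = ∑ i, l (EuclideanSpace.single i 1) • (EuclideanSpace.proj i : _ →L[ℝ] ℝ) := by
  ext v
  have hv : v = ∑ i, v i • EuclideanSpace.single i (1 : ℝ) := by
    ext j
    simp [Finset.sum_apply, Pi.single_apply]
  conv_lhs => rw [hv]
  simp [mul_comm]

/-- Chain rule. The factor `1 / (2 √(r i))` is singular on the walls, hence the restriction to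
positive variances. -/
theorem hasFDerivAt_comp_scaleNoise {n : ℕ}
    {Ψ : EuclideanSpace ℝ (Fin n) × (Fin n → ℂ) → ℝ}
    {Ψ' : EuclideanSpace ℝ (Fin n) × (Fin n → ℂ) →
      EuclideanSpace ℝ (Fin n) × (Fin n → ℂ) →L[ℝ] ℝ}
    (hd : ∀ w, HasFDerivAt Ψ (Ψ' w) w) {r : EuclideanSpace ℝ (Fin n)} (hr : ∀ i, 0 < r i)
    (z : Fin n → ℂ) :
    HasFDerivAt (fun r => Ψ (r, scaleNoise r z))
      (∑ i, (Ψ' (r, scaleNoise r z) (varDir i) + ∑ b, coord (i, b) z / (2 * Real.sqrt (r i)) *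
        Ψ' (r, scaleNoise r z) (fieldDir (i, b))) • (EuclideanSpace.proj i : _ →L[ℝ] ℝ)) r := by
  have h1 : HasFDerivAt (fun r : EuclideanSpace ℝ (Fin n) => scaleNoise r z)
      (ContinuousLinearMap.pi fun i => (EuclideanSpace.proj i : _ →L[ℝ] ℝ).smulRight
        ((1 / (2 * Real.sqrt (r i))) • z i)) r := by
    refine hasFDerivAt_pi.2 fun i => ?_
    have ha : HasFDerivAt (fun r : EuclideanSpace ℝ (Fin n) => r i)
        (EuclideanSpace.proj i : _ →L[ℝ] ℝ) r :=
      (EuclideanSpace.proj i : EuclideanSpace ℝ (Fin n) →L[ℝ] ℝ).hasFDerivAt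
    have hb := (ha.sqrt (hr i).ne').smul_const (z i)
    have hc : (fun r : EuclideanSpace ℝ (Fin n) => scaleNoise r z i) =
        fun r => Real.sqrt (r i) • z i := by
      funext r; simp [scaleNoise]
    rw [hc]
    convert! hb using 1
    ext v
    simp
    ring
  have h2 := (hd (r, scaleNoise r z)).comp r ((hasFDerivAt_id r).prodMk h1)
  convert! h2 using 1
  conv_rhs => rw [clm_eq_sum_proj (ContinuousLinearMap.comp _ _)]
  refine Finset.sum_congr rfl fun i _ => ?_
  congr 1
  have h3 : ((ContinuousLinearMap.id ℝ (EuclideanSpace ℝ (Fin n))).prod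
      (ContinuousLinearMap.pi fun i => (EuclideanSpace.proj i : _ →L[ℝ] ℝ).smulRight
        ((1 / (2 * Real.sqrt (r i))) • z i))) (EuclideanSpace.single i 1) =
      varDir i + ∑ b, (coord (i, b) z / (2 * Real.sqrt (r i))) • fieldDir (i, b) := by
    have h4 : ∀ b, (coord (i, b) z / (2 * Real.sqrt (r i))) • fieldDir (i, b) =
        ((0, (1 / (2 * Real.sqrt (r i))) • (coord (i, b) z • coordVec (i, b))) :
          EuclideanSpace ℝ (Fin n) × (Fin n → ℂ)) := by
      intro b
      simp only [fieldDir, Prod.smul_mk, smul_zero, smul_smul]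
      congr 2
      ring
    simp only [h4]
    refine Prod.ext ?_ ?_
    · simp [varDir]
    · simp only [varDir, Prod.snd_add, Prod.snd_sum, ← Finset.smul_sum, sum_coord_smul, zero_add]
      ext j
      by_cases h : j = i
      · subst h; simp
      · simp [h]
  rw [ContinuousLinearMap.comp_apply, h3]
  simp

theorem hasLineDerivAt_comp_scaleNoise {n : ℕ}
    {g : EuclideanSpace ℝ (Fin n) × (Fin n → ℂ) → ℝ} {g' : ℝ} (κ : Fin n × Bool)
    (r : EuclideanSpace ℝ (Fin n)) (z : Fin n → ℂ)
    (hd : HasLineDerivAt ℝ g g' (r, scaleNoise r z) (fieldDir κ)) :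
    HasLineDerivAt ℝ (fun z => g (r, scaleNoise r z)) (Real.sqrt (r κ.1) * g') z (coordVec κ) := by
  have h : HasDerivAt _ _ _ := hd.smul (Real.sqrt (r κ.1))
  refine h.congr_of_eventuallyEq (.of_forall fun t => ?_)
  have : scaleNoise r (z + t • coordVec κ) =
      scaleNoise r z + t • Real.sqrt (r κ.1) • coordVec κ := by
    ext j
    by_cases hj : j = κ.1
    · subst hj
      simp only [scaleNoise, coordVec, Pi.add_apply, Pi.smul_apply, Pi.single_eq_same,
        Complex.real_smul]
      ring
    · simp [scaleNoise, coordVec, hj]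
  simp only [this, fieldDir, Prod.smul_mk, smul_zero, Prod.mk_add_mk, add_zero]

/-- Stein's identity produces a factor `√r` from the inner scaling, which cancels the singular `1 /
√r`; the constant is `1 / 2 * 1 / 2`. The resulting formula makes sense up to the walls. -/
theorem integral_coord_mul_scaleNoise {n : ℕ}
    {g g' : EuclideanSpace ℝ (Fin n) × (Fin n → ℂ) → ℝ} (κ : Fin n × Bool)
    {r : EuclideanSpace ℝ (Fin n)} (hr : 0 < r κ.1)
    (hd : ∀ w, HasLineDerivAt ℝ g (g' w) w (fieldDir κ)) (hg : ExpGrowth g) (hg' : ExpGrowth g')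
    (hc : Integrable (fun z => coord κ z * g (r, scaleNoise r z)) (complexNoise n)) :
    ∫ z, coord κ z / (2 * Real.sqrt (r κ.1)) * g (r, scaleNoise r z) ∂complexNoise n =
      1 / 4 * ∫ z, g' (r, scaleNoise r z) ∂complexNoise n := by
  have hsq : Real.sqrt (r κ.1) ≠ 0 := (Real.sqrt_pos.2 hr).ne'
  have hst := integral_coord_mul_complexNoise κ (hg.integrable_scaleNoise r)
    ((hg'.integrable_scaleNoise r).const_mul (Real.sqrt (r κ.1))) hc
    fun z => hasLineDerivAt_comp_scaleNoise κ r z (hd _)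
  have : ∀ z : Fin n → ℂ, coord κ z / (2 * Real.sqrt (r κ.1)) * g (r, scaleNoise r z) =
      1 / (2 * Real.sqrt (r κ.1)) * (coord κ z * g (r, scaleNoise r z)) := fun z => by ring
  simp only [this]
  rw [integral_const_mul, hst, integral_const_mul]
  field_simp
  ring

/-- Differentiation of a Gaussian mean in the variances: each partial derivative is the mean of
the partial derivative plus a quarter of the Laplacian in the corresponding complex variable. -/
theorem hasFDerivAt_gaussMean {n : ℕ} {Ψ : EuclideanSpace ℝ (Fin n) × (Fin n → ℂ) → ℝ}
    {Ψ' : EuclideanSpace ℝ (Fin n) × (Fin n → ℂ) →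
      EuclideanSpace ℝ (Fin n) × (Fin n → ℂ) →L[ℝ] ℝ}
    {Ψ'' : Fin n × Bool → EuclideanSpace ℝ (Fin n) × (Fin n → ℂ) → ℝ}
    (hd : ∀ w, HasFDerivAt Ψ (Ψ' w) w)
    (hd2 : ∀ κ w, HasLineDerivAt ℝ (fun w => Ψ' w (fieldDir κ)) (Ψ'' κ w) w (fieldDir κ))
    (hg : ExpGrowth Ψ) (hgv : ∀ i, ExpGrowth fun w => Ψ' w (varDir i))
    (hgf : ∀ κ, ExpGrowth fun w => Ψ' w (fieldDir κ)) (hg2 : ∀ κ, ExpGrowth (Ψ'' κ))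
    {r : EuclideanSpace ℝ (Fin n)} (hr : ∀ i, 0 < r i) :
    HasFDerivAt (gaussMean Ψ)
      (∑ i, gaussMean (fun w => Ψ' w (varDir i) + 1 / 4 * ∑ b, Ψ'' (i, b) w) r •
        (EuclideanSpace.proj i : _ →L[ℝ] ℝ)) r := by
  -- On this neighbourhood `‖r'‖` is bounded and `r' i` stays above `r i / 2`, so `1 / √(r' i)` is
  -- bounded and domination is possible.
  set s : Set (EuclideanSpace ℝ (Fin n)) := {r' | ‖r'‖ < ‖r‖ + 1 ∧ ∀ i, r i / 2 < r' i} with hs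
  have hsn : s ∈ nhds r := by
    refine Filter.inter_mem ?_ ?_
    · exact (continuous_norm.tendsto r).eventually (gt_mem_nhds (lt_add_one _))
    · exact Filter.eventually_all.2 fun i =>
        ((EuclideanSpace.proj i : EuclideanSpace ℝ (Fin n) →L[ℝ] ℝ).continuous.tendsto r).eventually
          (lt_mem_nhds (half_lt_self (hr i)))
  choose D hD using fun i => (hgv i).exists_scaleNoise_bound (‖r‖ + 1)
  choose B hB using fun κ => (hgf κ).exists_scaleNoise_bound (‖r‖ + 1)
  have hcoord : ∀ (κ : Fin n × Bool) (z : Fin n → ℂ), |coord κ z| ≤ Real.exp ‖z‖ := fun κ z =>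
    (abs_coord_le κ z).trans (by linarith [Real.add_one_le_exp ‖z‖])
  have hBint : ∀ κ : Fin n × Bool,
      Integrable (fun z => Real.exp ‖z‖ * (B κ * Real.exp (B κ * ‖z‖))) (complexNoise n) := by
    intro κ
    refine ((integrable_exp_mul_norm n (1 + B κ)).const_mul (B κ)).congr (.of_forall fun z => ?_)
    simp only
    rw [add_mul, one_mul, Real.exp_add]
    ring
  have hcont : ∀ (i : Fin n), Continuous fun z => Ψ' (r, scaleNoise r z) (varDir i) +
      ∑ b, coord (i, b) z / (2 * Real.sqrt (r i)) * Ψ' (r, scaleNoise r z) (fieldDir (i, b)) := by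
    intro i
    refine ((hgv i).1.comp (continuous_scaleNoise_right r)).add
      (continuous_finsetSum _ fun b _ => Continuous.mul ?_
        ((hgf (i, b)).1.comp (continuous_scaleNoise_right r)))
    exact (coord (i, b)).continuous.div_const _
  have hmain := hasFDerivAt_integral_of_dominated_of_fderiv_le (𝕜 := ℝ) (μ := complexNoise n)
    (F := fun r z => Ψ (r, scaleNoise r z)) (x₀ := r) (s := s)
    (F' := fun r z => ∑ i, (Ψ' (r, scaleNoise r z) (varDir i) +
      ∑ b, coord (i, b) z / (2 * Real.sqrt (r i)) *
        Ψ' (r, scaleNoise r z) (fieldDir (i, b))) • (EuclideanSpace.proj i : _ →L[ℝ] ℝ))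
    (bound := fun z => ∑ i, (D i * Real.exp (D i * ‖z‖) +
      ∑ b, 1 / (2 * Real.sqrt (r i / 2)) *
        (Real.exp ‖z‖ * (B (i, b) * Real.exp (B (i, b) * ‖z‖)))) *
          ‖(EuclideanSpace.proj i : EuclideanSpace ℝ (Fin n) →L[ℝ] ℝ)‖)
    hsn
    (.of_forall fun r' => (hg.1.comp (continuous_scaleNoise_right r')).aestronglyMeasurable)
    (hg.integrable_scaleNoise r)
    (Continuous.aestronglyMeasurable
      (continuous_finsetSum _ fun i _ => (hcont i).smul continuous_const))
    (.of_forall fun z r' hr' => ?_)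
    (integrable_finsetSum _ fun i _ => (((integrable_exp_mul_norm n (D i)).const_mul _).add
      (integrable_finsetSum _ fun b _ => (hBint (i, b)).const_mul _)).mul_const _)
    (.of_forall fun z r' hr' => hasFDerivAt_comp_scaleNoise hd
      (fun i => (half_pos (hr i)).trans (hr'.2 i)) z)
  · refine hmain.congr_fderiv ?_
    -- Once integral and sum are exchanged, each field term is converted by Stein's identity, which
    -- needs the product with the coordinate to be integrable.
    have hstein : ∀ κ : Fin n × Bool,
        Integrable (fun z => coord κ z * Ψ' (r, scaleNoise r z) (fieldDir κ)) (complexNoise n) := by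
      intro κ
      refine (hBint κ).mono' (Continuous.aestronglyMeasurable
        ((coord κ).continuous.mul ((hgf κ).1.comp (continuous_scaleNoise_right r))))
        (.of_forall fun z => ?_)
      rw [norm_mul]
      exact mul_le_mul (hcoord κ z) (hB κ r (by linarith) z) (norm_nonneg _) (Real.exp_nonneg _)
    have hterm : ∀ (i : Fin n) (b : Bool), Integrable (fun z => coord (i, b) z /
        (2 * Real.sqrt (r i)) * Ψ' (r, scaleNoise r z) (fieldDir (i, b))) (complexNoise n) := by
      intro i b
      refine ((hstein (i, b)).div_const (2 * Real.sqrt (r i))).congr (.of_forall fun z => ?_)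
      simp only
      ring
    have hint : ∀ i : Fin n, Integrable (fun z => Ψ' (r, scaleNoise r z) (varDir i) +
        ∑ b, coord (i, b) z / (2 * Real.sqrt (r i)) *
          Ψ' (r, scaleNoise r z) (fieldDir (i, b))) (complexNoise n) := fun i =>
      ((hgv i).integrable_scaleNoise r).add (integrable_finsetSum _ fun b _ => hterm i b)
    rw [integral_finsetSum _ fun i _ => (hint i).smul_const _]
    refine Finset.sum_congr rfl fun i _ => ?_
    rw [integral_smul_const]
    congr 1
    have hi2 : ∀ κ, Integrable (fun z => Ψ'' κ (r, scaleNoise r z)) (complexNoise n) := fun κ =>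
      (hg2 κ).integrable_scaleNoise r
    unfold gaussMean
    rw [integral_add ((hgv i).integrable_scaleNoise r) (integrable_finsetSum _ fun b _ => hterm i b),
      integral_add ((hgv i).integrable_scaleNoise r)
        ((integrable_finsetSum _ fun b _ => hi2 (i, b)).const_mul _),
      integral_finsetSum _ fun b _ => hterm i b, integral_const_mul,
      integral_finsetSum _ fun b _ => hi2 (i, b), Finset.mul_sum]
    congr 1
    refine Finset.sum_congr rfl fun b _ => ?_
    exact integral_coord_mul_scaleNoise (i, b) (hr i) (hd2 (i, b)) (hgf (i, b)) (hg2 (i, b))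
      (hstein (i, b))
  · refine (norm_sum_le _ _).trans (Finset.sum_le_sum fun i _ => ?_)
    rw [norm_smul]
    refine mul_le_mul_of_nonneg_right ?_ (norm_nonneg _)
    refine (norm_add_le _ _).trans (add_le_add (hD i r' hr'.1.le z) ?_)
    refine (norm_sum_le _ _).trans (Finset.sum_le_sum fun b _ => ?_)
    have h1 : 0 < Real.sqrt (r i / 2) := Real.sqrt_pos.2 (half_pos (hr i))
    have h2 : Real.sqrt (r i / 2) ≤ Real.sqrt (r' i) := Real.sqrt_le_sqrt (hr'.2 i).le
    have h3 : coord (i, b) z / (2 * Real.sqrt (r' i)) * Ψ' (r', scaleNoise r' z) (fieldDir (i, b)) =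
        1 / (2 * Real.sqrt (r' i)) *
          (coord (i, b) z * Ψ' (r', scaleNoise r' z) (fieldDir (i, b))) := by ring
    rw [h3, norm_mul, norm_mul, Real.norm_of_nonneg (by positivity)]
    refine mul_le_mul ?_ (mul_le_mul (hcoord _ z) (hB (i, b) r' hr'.1.le z) (norm_nonneg _)
      (Real.exp_nonneg _)) (by positivity) (by positivity)
    gcongr

/-! ### Exponential sums -/

section ExpSum

variable {W K : Type*} [NormedAddCommGroup W] [NormedSpace ℝ W] [Fintype K]

/-- The exponential sum `∑ₖ fₖ exp (lₖ w)`. -/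
noncomputable def expSum (l : K → W →L[ℝ] ℝ) (f : K → ℝ) (w : W) : ℝ :=
  ∑ k, f k * Real.exp (l k w)

/-- The partition function `∑ₖ exp (lₖ w)`. -/
noncomputable def partitionSum (l : K → W →L[ℝ] ℝ) (w : W) : ℝ := ∑ k, Real.exp (l k w)

/-- The mean of `f` under the Gibbs weights `exp (lₖ w)`. -/
noncomputable def gibbsMean (l : K → W →L[ℝ] ℝ) (f : K → ℝ) (w : W) : ℝ :=
  expSum l f w / partitionSum l w

/-- The covariance of `f` and `g` under the Gibbs weights `exp (lₖ w)`. -/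
noncomputable def gibbsCov (l : K → W →L[ℝ] ℝ) (f g : K → ℝ) (w : W) : ℝ :=
  gibbsMean l (fun k => f k * g k) w - gibbsMean l f w * gibbsMean l g w

theorem partitionSum_eq_expSum (l : K → W →L[ℝ] ℝ) : partitionSum l = expSum l fun _ => 1 := by
  funext w; simp [partitionSum, expSum]

theorem partitionSum_pos [Nonempty K] (l : K → W →L[ℝ] ℝ) (w : W) : 0 < partitionSum l w :=
  Finset.sum_pos (fun _ _ => Real.exp_pos _) Finset.univ_nonempty

theorem hasFDerivAt_expSum (l : K → W →L[ℝ] ℝ) (f : K → ℝ) (w : W) :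
    HasFDerivAt (expSum l f) (∑ k, (f k * Real.exp (l k w)) • l k) w := by
  unfold expSum
  refine HasFDerivAt.fun_sum fun k _ => ?_
  have := ((l k).hasFDerivAt (x := w)).exp.const_mul (f k)
  rwa [smul_smul] at this

theorem hasFDerivAt_partitionSum (l : K → W →L[ℝ] ℝ) (w : W) :
    HasFDerivAt (partitionSum l) (∑ k, Real.exp (l k w) • l k) w := by
  rw [partitionSum_eq_expSum]
  simpa using hasFDerivAt_expSum l (fun _ => 1) w

theorem sum_smul_clm_apply (l : K → W →L[ℝ] ℝ) (f : K → ℝ) (w v : W) :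
    (∑ k, (f k * Real.exp (l k w)) • l k) v = expSum l (fun k => f k * l k v) w := by
  simp only [expSum, sum_apply, smul_apply, smul_eq_mul]
  exact Finset.sum_congr rfl fun k _ => by ring

theorem sum_exp_smul_clm_apply (l : K → W →L[ℝ] ℝ) (w v : W) :
    (∑ k, Real.exp (l k w) • l k) v = expSum l (fun k => l k v) w := by
  simpa using sum_smul_clm_apply l (fun _ => 1) w v

theorem hasLineDerivAt_expSum (l : K → W →L[ℝ] ℝ) (f : K → ℝ) (w v : W) :
    HasLineDerivAt ℝ (expSum l f) (expSum l (fun k => f k * l k v) w) w v := by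
  rw [← sum_smul_clm_apply]
  exact (hasFDerivAt_expSum l f w).hasLineDerivAt v

theorem hasLineDerivAt_partitionSum (l : K → W →L[ℝ] ℝ) (w v : W) :
    HasLineDerivAt ℝ (partitionSum l) (expSum l (fun k => l k v) w) w v := by
  rw [← sum_exp_smul_clm_apply]
  exact (hasFDerivAt_partitionSum l w).hasLineDerivAt v

theorem expGrowth_expSum (l : K → W →L[ℝ] ℝ) (f : K → ℝ) : ExpGrowth (expSum l f) :=
  ExpGrowth.sum _ fun k _ => (ExpGrowth.exp_clm (l k)).const_mul (f k)

theorem expGrowth_partitionSum (l : K → W →L[ℝ] ℝ) : ExpGrowth (partitionSum l) :=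
  ExpGrowth.sum _ fun k _ => ExpGrowth.exp_clm (l k)

theorem expSum_eq_gibbsMean_mul [Nonempty K] (l : K → W →L[ℝ] ℝ) (f : K → ℝ) (w : W) :
    expSum l f w = gibbsMean l f w * partitionSum l w :=
  (div_mul_cancel₀ _ (partitionSum_pos l w).ne').symm

/-- A weighted average of the `f k` is bounded by `∑ |f k|`, whatever the exponents. -/
theorem expGrowth_gibbsMean [Nonempty K] (l : K → W →L[ℝ] ℝ) (f : K → ℝ) :
    ExpGrowth (gibbsMean l f) := by
  refine ExpGrowth.of_bounded (C := ∑ k, |f k|)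
    ((expGrowth_expSum l f).1.div (expGrowth_partitionSum l).1
      fun w => (partitionSum_pos l w).ne') fun w => ?_
  unfold gibbsMean
  rw [abs_div, abs_of_pos (partitionSum_pos l w), div_le_iff₀ (partitionSum_pos l w),
    Finset.sum_mul]
  refine (Finset.abs_sum_le_sum_abs _ _).trans (Finset.sum_le_sum fun k _ => ?_)
  rw [abs_mul, abs_of_pos (Real.exp_pos _)]
  refine mul_le_mul_of_nonneg_left ?_ (abs_nonneg _)
  exact Finset.single_le_sum (f := fun k => Real.exp (l k w)) (fun _ _ => (Real.exp_pos _).le)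
    (Finset.mem_univ k)

theorem expGrowth_gibbsCov [Nonempty K] (l : K → W →L[ℝ] ℝ) (f g : K → ℝ) :
    ExpGrowth (gibbsCov l f g) :=
  (expGrowth_gibbsMean l _).sub ((expGrowth_gibbsMean l f).mul (expGrowth_gibbsMean l g))

/-- One term bounds `log Q` from below: `1 - exp (-l k₀) ≤ l k₀ ≤ log Q ≤ Q - 1`. Hence `|log Q| ≤ Q
+ exp (-l k₀)`. -/
theorem expGrowth_log_partitionSum [Nonempty K] (l : K → W →L[ℝ] ℝ) :
    ExpGrowth fun w => Real.log (partitionSum l w) := by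
  obtain ⟨k₀⟩ := ‹Nonempty K›
  obtain ⟨C, -, hC⟩ :=
    ((expGrowth_partitionSum l).add (ExpGrowth.exp_clm (-(l k₀)))).exists_pos_bound
  have : Nonempty K := ⟨k₀⟩
  refine ⟨(expGrowth_partitionSum l).1.log fun w => (partitionSum_pos l w).ne', C, fun w => ?_⟩
  refine le_trans ?_ ((le_abs_self _).trans (hC w))
  have hQ := partitionSum_pos l w
  have h1 := Real.log_le_sub_one_of_pos hQ
  have h2 : l k₀ w ≤ Real.log (partitionSum l w) := by
    rw [Real.le_log_iff_exp_le hQ]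
    exact Finset.single_le_sum (f := fun k => Real.exp (l k w)) (fun _ _ => (Real.exp_pos _).le)
      (Finset.mem_univ k₀)
  have h3 := Real.add_one_le_exp ((-(l k₀)) w)
  rw [neg_apply] at h3 ⊢
  have h4 := Real.exp_pos (-(l k₀ w))
  rw [abs_le]
  constructor <;> linarith

theorem hasLineDerivAt_gibbsMean [Nonempty K] (l : K → W →L[ℝ] ℝ) (f : K → ℝ) (w v : W) :
    HasLineDerivAt ℝ (gibbsMean l f) (gibbsCov l f (fun k => l k v) w) w v := by
  have h1 : HasDerivAt _ _ _ := hasLineDerivAt_expSum l f w v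
  have h2 : HasDerivAt _ _ _ := hasLineDerivAt_partitionSum l w v
  have hQ := (partitionSum_pos l w).ne'
  have h3 : HasDerivAt _ _ _ := h1.div h2 (by simpa using hQ)
  refine HasDerivAt.congr_deriv h3 ?_
  simp only [zero_smul, add_zero, gibbsCov, gibbsMean]
  field_simp

/-- The potential `Q log Q` of the partition function `Q`. -/
noncomputable def entropyPotential (l : K → W →L[ℝ] ℝ) (w : W) : ℝ :=
  partitionSum l w * Real.log (partitionSum l w)

theorem hasFDerivAt_entropyPotential [Nonempty K] (l : K → W →L[ℝ] ℝ) (w : W) :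
    HasFDerivAt (entropyPotential l)
      ((Real.log (partitionSum l w) + 1) • ∑ k, Real.exp (l k w) • l k) w := by
  have hQ := (partitionSum_pos l w).ne'
  have h := hasFDerivAt_partitionSum l w
  refine (h.mul (h.log hQ)).congr_fderiv ?_
  rw [smul_smul, mul_inv_cancel₀ hQ, ← add_smul, add_comm]

theorem entropyPotential_fderiv_apply (l : K → W →L[ℝ] ℝ) (w v : W) :
    ((Real.log (partitionSum l w) + 1) • ∑ k, Real.exp (l k w) • l k) v =
      (Real.log (partitionSum l w) + 1) * expSum l (fun k => l k v) w := by
  rw [smul_apply, sum_exp_smul_clm_apply, smul_eq_mul]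

/-- The first summand, the square of the derivative of `Q` over `Q`, is the one that survives; the
second, summed over the field directions, will cancel against the derivative in the variance. -/
theorem hasLineDerivAt_entropyPotential_fderiv [Nonempty K] (l : K → W →L[ℝ] ℝ) (w v : W) :
    HasLineDerivAt ℝ
      (fun w => ((Real.log (partitionSum l w) + 1) • ∑ k, Real.exp (l k w) • l k) v)
      (gibbsMean l (fun k => l k v) w * expSum l (fun k => l k v) w +
        (Real.log (partitionSum l w) + 1) * expSum l (fun k => l k v * l k v) w) w v := by
  simp only [entropyPotential_fderiv_apply]
  have hQ := (partitionSum_pos l w).ne'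
  have h1 : HasDerivAt _ _ _ := hasLineDerivAt_expSum l (fun k => l k v) w v
  have h2 : HasDerivAt _ _ _ := hasLineDerivAt_partitionSum l w v
  have h3 : HasDerivAt _ _ _ := ((h2.log (by simpa using hQ)).add_const 1).mul h1
  refine HasDerivAt.congr_deriv h3 ?_
  simp only [zero_smul, add_zero, gibbsMean]

/-- The energy `(∑ₖ fₖ exp (lₖ w))² / ∑ₖ exp (lₖ w)`. -/
noncomputable def gibbsEnergy (l : K → W →L[ℝ] ℝ) (f : K → ℝ) (w : W) : ℝ :=
  gibbsMean l f w * expSum l f w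

theorem expGrowth_gibbsEnergy [Nonempty K] (l : K → W →L[ℝ] ℝ) (f : K → ℝ) :
    ExpGrowth (gibbsEnergy l f) :=
  (expGrowth_gibbsMean l f).mul (expGrowth_expSum l f)

theorem hasFDerivAt_gibbsEnergy [Nonempty K] (l : K → W →L[ℝ] ℝ) (f : K → ℝ) (w : W) :
    HasFDerivAt (gibbsEnergy l f)
      ((2 * gibbsMean l f w) • ∑ k, (f k * Real.exp (l k w)) • l k -
        gibbsMean l f w ^ 2 • ∑ k, Real.exp (l k w) • l k) w := by
  have hQ := (partitionSum_pos l w).ne'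
  have h1 := (hasDerivAt_inv hQ).comp_hasFDerivAt w (hasFDerivAt_partitionSum l w)
  have h2 := hasFDerivAt_expSum l f w
  have h3 := (h2.mul h1).mul h2
  refine HasFDerivAt.congr_fderiv h3 ?_
  ext v
  simp only [gibbsMean, Pi.mul_apply, Function.comp_apply, add_apply,
    smul_apply, sub_apply, sum_smul_clm_apply,
    sum_exp_smul_clm_apply, smul_eq_mul]
  field_simp
  ring

theorem gibbsEnergy_fderiv_apply (l : K → W →L[ℝ] ℝ) (f : K → ℝ) (w v : W) :
    ((2 * gibbsMean l f w) • ∑ k, (f k * Real.exp (l k w)) • l k -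
        gibbsMean l f w ^ 2 • ∑ k, Real.exp (l k w) • l k) v =
      2 * gibbsMean l f w * expSum l (fun k => f k * l k v) w -
        gibbsMean l f w ^ 2 * expSum l (fun k => l k v) w := by
  rw [sub_apply, smul_apply,
    smul_apply, sum_exp_smul_clm_apply, sum_smul_clm_apply, smul_eq_mul,
    smul_eq_mul]

/-- With `N = expSum l f`, the covariance term is the Hessian of the convex function `N² / Q` of
`(N, Q)`. The other two pair its gradient with the second derivatives of `N` and `Q`, and will
cancel against the derivative in the variance. -/
theorem hasLineDerivAt_gibbsEnergy_fderiv [Nonempty K] (l : K → W →L[ℝ] ℝ) (f : K → ℝ)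
    (w v : W) :
    HasLineDerivAt ℝ
      (fun w => ((2 * gibbsMean l f w) • ∑ k, (f k * Real.exp (l k w)) • l k -
        gibbsMean l f w ^ 2 • ∑ k, Real.exp (l k w) • l k) v)
      (2 * partitionSum l w * gibbsCov l f (fun k => l k v) w ^ 2 +
        2 * gibbsMean l f w * expSum l (fun k => f k * l k v * l k v) w -
        gibbsMean l f w ^ 2 * expSum l (fun k => l k v * l k v) w) w v := by
  simp only [gibbsEnergy_fderiv_apply]
  have hQ := (partitionSum_pos l w).ne'
  have h1 : HasDerivAt _ _ _ := hasLineDerivAt_expSum l (fun k => l k v) w v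
  have h2 : HasDerivAt _ _ _ := hasLineDerivAt_expSum l (fun k => f k * l k v) w v
  have h3 : HasDerivAt _ _ _ := hasLineDerivAt_gibbsMean l f w v
  have h4 : HasDerivAt _ _ _ := ((h3.const_mul 2).mul h2).sub ((h3.pow 2).mul h1)
  refine HasDerivAt.congr_deriv h4 ?_
  simp only [zero_smul, add_zero, Pi.pow_apply, gibbsCov]
  rw [expSum_eq_gibbsMean_mul l (fun k => f k * l k v), expSum_eq_gibbsMean_mul l (fun k => l k v)]
  push_cast
  ring

/-- Gibbs covariances as a double sum of a kernel: their entrywise squares form a positive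
semidefinite matrix. -/
theorem sum_mul_gibbsCov_sq_nonneg [Nonempty K] {ι : Type*} [Fintype ι] (l : K → W →L[ℝ] ℝ)
    (f : ι → K → ℝ) (v : ι → ℝ) (w : W) :
    0 ≤ ∑ i, ∑ j, v i * v j * gibbsCov l (f i) (f j) w ^ 2 := by
  set p : K → ℝ := fun k => Real.exp (l k w) / partitionSum l w with hp
  set d : ι → K → ℝ := fun i k => f i k - gibbsMean l (f i) w with hd
  have hQ := (partitionSum_pos l w).ne'
  have hp0 : ∀ k, 0 ≤ p k := fun k => div_nonneg (Real.exp_pos _).le (partitionSum_pos l w).le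
  have hp1 : ∑ k, p k = 1 := by
    simp only [hp, ← Finset.sum_div]
    exact div_self hQ
  have hmean : ∀ g : K → ℝ, gibbsMean l g w = ∑ k, p k * g k := by
    intro g
    simp only [gibbsMean, expSum, Finset.sum_div, hp]
    exact Finset.sum_congr rfl fun k _ => by ring
  have hcov : ∀ i j, gibbsCov l (f i) (f j) w = ∑ k, p k * (d i k * d j k) := by
    intro i j
    have : ∀ k, p k * (d i k * d j k) = p k * (f i k * f j k) -
        gibbsMean l (f j) w * (p k * f i k) - gibbsMean l (f i) w * (p k * f j k) +
        gibbsMean l (f i) w * gibbsMean l (f j) w * p k := fun k => by simp only [hd]; ring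
    simp only [this, Finset.sum_add_distrib, Finset.sum_sub_distrib, ← Finset.mul_sum, ← hmean,
      hp1, gibbsCov]
    ring
  -- Two independent copies `k`, `k'` of the Gibbs variable: a squared covariance is the mean of `d
  -- i k * d i k' * (d j k * d j k')`, so the quadratic form is the mean of a square.
  have key : ∑ i, ∑ j, v i * v j * gibbsCov l (f i) (f j) w ^ 2 =
      ∑ k, ∑ k', p k * p k' * (∑ i, v i * (d i k * d i k')) ^ 2 := by
    have h1 : ∀ i j, v i * v j * gibbsCov l (f i) (f j) w ^ 2 =
        ∑ k, ∑ k', p k * p k' * (v i * (d i k * d i k')) * (v j * (d j k * d j k')) := by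
      intro i j
      rw [hcov, sq, Finset.sum_mul_sum, Finset.mul_sum]
      refine Finset.sum_congr rfl fun k _ => ?_
      rw [Finset.mul_sum]
      exact Finset.sum_congr rfl fun k' _ => by ring
    have h2 : ∀ k k', p k * p k' * (∑ i, v i * (d i k * d i k')) ^ 2 =
        ∑ i, ∑ j, p k * p k' * (v i * (d i k * d i k')) * (v j * (d j k * d j k')) := by
      intro k k'
      rw [sq, Finset.sum_mul_sum, Finset.mul_sum]
      refine Finset.sum_congr rfl fun i _ => ?_
      rw [Finset.mul_sum]
      exact Finset.sum_congr rfl fun j _ => by ring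
    simp only [h1, h2]
    calc _ = ∑ i, ∑ k, ∑ j, ∑ k', p k * p k' * (v i * (d i k * d i k')) *
          (v j * (d j k * d j k')) := Finset.sum_congr rfl fun i _ => Finset.sum_comm
      _ = ∑ k, ∑ i, ∑ j, ∑ k', p k * p k' * (v i * (d i k * d i k')) *
          (v j * (d j k * d j k')) := Finset.sum_comm
      _ = ∑ k, ∑ i, ∑ k', ∑ j, p k * p k' * (v i * (d i k * d i k')) *
          (v j * (d j k * d j k')) := Finset.sum_congr rfl fun k _ =>
            Finset.sum_congr rfl fun i _ => Finset.sum_comm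
      _ = _ := Finset.sum_congr rfl fun k _ => Finset.sum_comm
  rw [key]
  exact Finset.sum_nonneg fun k _ => Finset.sum_nonneg fun k' _ =>
    mul_nonneg (mul_nonneg (hp0 k) (hp0 k')) (sq_nonneg _)

theorem gibbsCov_comm (l : K → W →L[ℝ] ℝ) (f g : K → ℝ) (w : W) :
    gibbsCov l f g w = gibbsCov l g f w := by
  simp only [gibbsCov, mul_comm]

theorem expSum_const_mul (l : K → W →L[ℝ] ℝ) (a : ℝ) (f : K → ℝ) (w : W) :
    expSum l (fun k => a * f k) w = a * expSum l f w := by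
  simp only [expSum, Finset.mul_sum, mul_assoc]

theorem expSum_neg (l : K → W →L[ℝ] ℝ) (f : K → ℝ) (w : W) :
    expSum l (fun k => -f k) w = -expSum l f w := by
  simp only [expSum, neg_mul, Finset.sum_neg_distrib]

theorem expSum_sum {ι : Type*} (s : Finset ι) (l : K → W →L[ℝ] ℝ) (f : ι → K → ℝ) (w : W) :
    expSum l (fun k => ∑ i ∈ s, f i k) w = ∑ i ∈ s, expSum l (f i) w := by
  simp only [expSum, Finset.sum_mul]
  exact Finset.sum_comm

theorem gibbsMean_const_mul (l : K → W →L[ℝ] ℝ) (a : ℝ) (f : K → ℝ) (w : W) :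
    gibbsMean l (fun k => a * f k) w = a * gibbsMean l f w := by
  simp only [gibbsMean, expSum_const_mul, mul_div_assoc]

theorem gibbsCov_const_mul_right (l : K → W →L[ℝ] ℝ) (a : ℝ) (f g : K → ℝ) (w : W) :
    gibbsCov l f (fun k => a * g k) w = a * gibbsCov l f g w := by
  have : (fun k => f k * (a * g k)) = fun k => a * (f k * g k) := by funext k; ring
  simp only [gibbsCov, this, gibbsMean_const_mul]
  ring

end ExpSum

/-! ### The exponents of a family of signal vectors -/

section Signals

variable {n : ℕ} {K : Type*}

/-- The log-likelihood ratio of the signal `a k`, as a linear functional of the variances `r` and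
the scaled output `u`: `∑ᵢ 2 Re (conj (aₖᵢ) uᵢ) - rᵢ |aₖᵢ|²`. -/
noncomputable def signalExponent (a : K → Fin n → ℂ) (k : K) :
    EuclideanSpace ℝ (Fin n) × (Fin n → ℂ) →L[ℝ] ℝ :=
  ∑ κ, ((2 * coord κ (a k)) • (coord κ ∘L ContinuousLinearMap.snd ℝ _ _) -
    (coord κ (a k) ^ 2) • ((EuclideanSpace.proj κ.1 : EuclideanSpace ℝ (Fin n) →L[ℝ] ℝ) ∘L
      ContinuousLinearMap.fst ℝ _ _))

theorem signalExponent_apply (a : K → Fin n → ℂ) (k : K)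
    (w : EuclideanSpace ℝ (Fin n) × (Fin n → ℂ)) :
    signalExponent a k w =
      ∑ κ, (2 * coord κ (a k) * coord κ w.2 - coord κ (a k) ^ 2 * w.1 κ.1) := by
  simp [signalExponent]

theorem signalExponent_varDir (a : K → Fin n → ℂ) (k : K) (j : Fin n) :
    signalExponent a k (varDir j) = -∑ b, coord (j, b) (a k) ^ 2 := by
  rw [signalExponent_apply, Fintype.sum_prod_type, Finset.sum_eq_single j]
  · simp [varDir]
  · intro i _ hij
    simp [varDir, hij]
  · simp

/-- Together with `signalExponent_varDir` this is the cancellation behind the proof: `-|aᵢ|² + ¼ ∑_b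
(2 aᵢ_b)² = 0`, so each exponential is annihilated by the heat operator in every variable. -/
theorem signalExponent_fieldDir (a : K → Fin n → ℂ) (k : K) (κ : Fin n × Bool) :
    signalExponent a k (fieldDir κ) = 2 * coord κ (a k) := by
  rw [signalExponent_apply]
  simp [fieldDir, coord_coordVec]

theorem coord_scaleNoise (r : EuclideanSpace ℝ (Fin n)) (z : Fin n → ℂ) (κ : Fin n × Bool) :
    coord κ (scaleNoise r z) = Real.sqrt (r κ.1) * coord κ z := by
  obtain ⟨i, b⟩ := κ
  cases b
  · simp [coord_false, scaleNoise]
  · simp [coord_true, scaleNoise]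

theorem sqNorm_scaleNoise {r : EuclideanSpace ℝ (Fin n)} (hr : r ∈ powerVectors n)
    (z : Fin n → ℂ) : sqNorm (scaleNoise r z) = ∑ i, r i * ‖z i‖ ^ 2 := by
  refine Finset.sum_congr rfl fun i _ => ?_
  rw [scaleNoise, norm_mul, mul_pow, Complex.norm_real, Real.norm_eq_abs, sq_abs,
    Real.sq_sqrt (hr i)]

/-- Only on the orthant does `√r * √r = r` hold, which makes the linear functional of `(r, u)` agree
with the log-likelihood ratio. -/
theorem signalExponent_scaleNoise (a : K → Fin n → ℂ) (k : K) {r : EuclideanSpace ℝ (Fin n)}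
    (hr : r ∈ powerVectors n) (z : Fin n → ℂ) :
    signalExponent a k (r, scaleNoise r z) = -sqNorm (z - scaleNoise r (a k)) + sqNorm z := by
  rw [signalExponent_apply, sqNorm_eq_sum_coord, sqNorm_eq_sum_coord, ← Finset.sum_neg_distrib,
    ← Finset.sum_add_distrib]
  refine Finset.sum_congr rfl fun κ _ => ?_
  rw [map_sub, coord_scaleNoise, coord_scaleNoise]
  have := Real.sq_sqrt (hr κ.1)
  simp only
  linear_combination coord κ (a k) ^ 2 * this

variable [Fintype K] [Nonempty K]

theorem gaussMean_sum {ι : Type*} (s : Finset ι)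
    {Ψ : ι → EuclideanSpace ℝ (Fin n) × (Fin n → ℂ) → ℝ} (h : ∀ i ∈ s, ExpGrowth (Ψ i))
    (r : EuclideanSpace ℝ (Fin n)) :
    gaussMean (fun w => ∑ i ∈ s, Ψ i w) r = ∑ i ∈ s, gaussMean (Ψ i) r :=
  integral_finsetSum _ fun i hi => (h i hi).integrable_scaleNoise r

/-- The derivative of the mean entropy potential in the `i`-th variance. -/
noncomputable def meanEnergy (a : K → Fin n → ℂ) (i : Fin n) (r : EuclideanSpace ℝ (Fin n)) : ℝ :=
  ∑ b, gaussMean (gibbsEnergy (signalExponent a) fun k => coord (i, b) (a k)) r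

/-- The second derivative of the mean entropy potential in the `i`-th and `j`-th variances. -/
noncomputable def meanSqCov (a : K → Fin n → ℂ) (i j : Fin n) (r : EuclideanSpace ℝ (Fin n)) : ℝ :=
  ∑ b, gaussMean (fun w => 2 * partitionSum (signalExponent a) w * ∑ b',
    gibbsCov (signalExponent a) (fun k => coord (i, b) (a k)) (fun k => coord (j, b') (a k)) w ^ 2)
    r

theorem expGrowth_entropyPotential (a : K → Fin n → ℂ) :
    ExpGrowth (entropyPotential (signalExponent a)) :=
  (expGrowth_partitionSum _).mul (expGrowth_log_partitionSum _)

theorem expGrowth_sqCov (a : K → Fin n → ℂ) (f : K → ℝ) (j : Fin n) :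
    ExpGrowth fun w => 2 * partitionSum (signalExponent a) w * ∑ b',
      gibbsCov (signalExponent a) f (fun k => coord (j, b') (a k)) w ^ 2 :=
  ((expGrowth_partitionSum _).const_mul 2).mul
    (ExpGrowth.sum _ fun _ _ => (expGrowth_gibbsCov _ _ _).pow 2)

theorem continuous_meanEnergy (a : K → Fin n → ℂ) (i : Fin n) : Continuous (meanEnergy a i) :=
  continuous_finsetSum _ fun _ _ => (expGrowth_gibbsEnergy _ _).continuous_gaussMean

theorem continuous_meanSqCov (a : K → Fin n → ℂ) (i j : Fin n) :
    Continuous (meanSqCov a i j) :=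
  continuous_finsetSum _ fun _ _ => (expGrowth_sqCov a _ j).continuous_gaussMean

/-- The terms carrying `log Q + 1` multiply the heat operator applied to `Q`, which is zero. There
remains a quarter of the squared field gradient of `Q` over `Q`, and the doubled coordinates cancel
the quarter. -/
theorem hasFDerivAt_gaussMean_entropyPotential (a : K → Fin n → ℂ)
    {r : EuclideanSpace ℝ (Fin n)} (hr : ∀ i, 0 < r i) :
    HasFDerivAt (gaussMean (entropyPotential (signalExponent a)))
      (∑ i, meanEnergy a i r • (EuclideanSpace.proj i : _ →L[ℝ] ℝ)) r := by
  have hdir : ∀ v, ExpGrowth fun w => ((Real.log (partitionSum (signalExponent a) w) + 1) •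
      ∑ k, Real.exp (signalExponent a k w) • signalExponent a k) v := by
    intro v
    simp only [entropyPotential_fderiv_apply]
    exact ((expGrowth_log_partitionSum _).add (ExpGrowth.const 1)).mul (expGrowth_expSum _ _)
  refine (hasFDerivAt_gaussMean (hasFDerivAt_entropyPotential (signalExponent a))
    (fun κ w => hasLineDerivAt_entropyPotential_fderiv (signalExponent a) w (fieldDir κ))
    (expGrowth_entropyPotential a) (fun i => hdir _) (fun κ => hdir _) (fun κ => ?_)
    hr).congr_fderiv ?_
  · exact ((expGrowth_gibbsMean _ _).mul (expGrowth_expSum _ _)).add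
      (((expGrowth_log_partitionSum _).add (ExpGrowth.const 1)).mul (expGrowth_expSum _ _))
  · refine Finset.sum_congr rfl fun i _ => ?_
    congr 1
    unfold meanEnergy
    rw [← gaussMean_sum _ fun b _ => expGrowth_gibbsEnergy _ _]
    congr 1
    funext w
    have h4 : ∀ x : ℝ, 2 * x * (2 * x) = 4 * x ^ 2 := fun x => by ring
    simp only [entropyPotential_fderiv_apply, signalExponent_varDir, signalExponent_fieldDir,
      expSum_neg, expSum_sum, h4, expSum_const_mul, gibbsMean_const_mul, gibbsEnergy]
    simp only [Fintype.sum_bool]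
    ring

/-- Numerator and denominator of the energy both solve the heat equation, so only the covariance
term is left: `¼ * 2 Q * (2 Cov)² = 2 Q Cov²`. -/
theorem hasFDerivAt_gaussMean_gibbsEnergy (a : K → Fin n → ℂ) (f : K → ℝ)
    {r : EuclideanSpace ℝ (Fin n)} (hr : ∀ i, 0 < r i) :
    HasFDerivAt (gaussMean (gibbsEnergy (signalExponent a) f))
      (∑ j, gaussMean (fun w => 2 * partitionSum (signalExponent a) w * ∑ b',
        gibbsCov (signalExponent a) f (fun k => coord (j, b') (a k)) w ^ 2) r •
          (EuclideanSpace.proj j : _ →L[ℝ] ℝ)) r := by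
  have hdir : ∀ v, ExpGrowth fun w => ((2 * gibbsMean (signalExponent a) f w) •
      ∑ k, (f k * Real.exp (signalExponent a k w)) • signalExponent a k -
        gibbsMean (signalExponent a) f w ^ 2 •
          ∑ k, Real.exp (signalExponent a k w) • signalExponent a k) v := by
    intro v
    simp only [gibbsEnergy_fderiv_apply]
    exact (((expGrowth_gibbsMean _ _).const_mul 2).mul (expGrowth_expSum _ _)).sub
      (((expGrowth_gibbsMean _ _).pow 2).mul (expGrowth_expSum _ _))
  refine (hasFDerivAt_gaussMean (hasFDerivAt_gibbsEnergy (signalExponent a) f)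
    (fun κ w => hasLineDerivAt_gibbsEnergy_fderiv (signalExponent a) f w (fieldDir κ))
    (expGrowth_gibbsEnergy _ _) (fun i => hdir _) (fun κ => hdir _) (fun κ => ?_)
    hr).congr_fderiv ?_
  · exact ((((expGrowth_partitionSum _).const_mul 2).mul ((expGrowth_gibbsCov _ _ _).pow 2)).add
      (((expGrowth_gibbsMean _ _).const_mul 2).mul (expGrowth_expSum _ _))).sub
        (((expGrowth_gibbsMean _ _).pow 2).mul (expGrowth_expSum _ _))
  · refine Finset.sum_congr rfl fun j _ => ?_
    congr 2
    funext w
    have h4 : ∀ x : ℝ, 2 * x * (2 * x) = 4 * x ^ 2 := fun x => by ring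
    have h5 : ∀ k (x : ℝ), f k * (2 * x) * (2 * x) = 4 * (f k * x ^ 2) := fun k x => by ring
    have h6 : ∀ k, f k * -∑ b, coord (j, b) (a k) ^ 2 =
        -∑ b, f k * coord (j, b) (a k) ^ 2 := fun k => by rw [mul_neg, Finset.mul_sum]
    simp only [gibbsEnergy_fderiv_apply, signalExponent_varDir, signalExponent_fieldDir, h6,
      expSum_neg, expSum_sum, h4, h5, expSum_const_mul, gibbsCov_const_mul_right]
    simp only [Fintype.sum_bool]
    ring

/-! ### The closed orthant -/

theorem convex_powerVectors (n : ℕ) : Convex ℝ (powerVectors n) := by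
  intro x hx y hy s t hs ht _ i
  have h1 := mul_nonneg hs (hx i)
  have h2 := mul_nonneg ht (hy i)
  simpa using add_nonneg h1 h2

theorem isOpen_posOrthant (n : ℕ) : IsOpen {r : EuclideanSpace ℝ (Fin n) | ∀ i, 0 < r i} := by
  simp only [Set.ofPred_forall]
  exact isOpen_iInter_of_finite fun i =>
    isOpen_lt continuous_const (EuclideanSpace.proj i : EuclideanSpace ℝ (Fin n) →L[ℝ] ℝ).continuous

theorem convex_posOrthant (n : ℕ) : Convex ℝ {r : EuclideanSpace ℝ (Fin n) | ∀ i, 0 < r i} := by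
  intro x hx y hy s t hs ht hst i
  have : 0 < s * x i + t * y i := by
    rcases hs.eq_or_lt with rfl | hs
    · have : t = 1 := by linarith
      simpa [this] using hy i
    · have := mul_pos hs (hx i)
      have := mul_nonneg ht (hy i).le
      linarith
  simpa using this

theorem closure_posOrthant (n : ℕ) :
    closure {r : EuclideanSpace ℝ (Fin n) | ∀ i, 0 < r i} = powerVectors n := by
  refine Set.Subset.antisymm (closure_minimal (fun r hr i => (hr i).le) ?_) fun r hr => ?_
  · simp only [powerVectors, Set.ofPred_forall]
    exact isClosed_iInter fun i => isClosed_le continuous_const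
      (EuclideanSpace.proj i : EuclideanSpace ℝ (Fin n) →L[ℝ] ℝ).continuous
  · have hc : Continuous fun t : ℝ => r + t • (WithLp.toLp 2 fun _ => (1 : ℝ) :
        EuclideanSpace ℝ (Fin n)) := by fun_prop
    have ht := (hc.tendsto 0).mono_left (nhdsWithin_le_nhds (s := Set.Ioi 0))
    simp only [zero_smul, add_zero] at ht
    refine mem_closure_of_tendsto ht ?_
    filter_upwards [self_mem_nhdsWithin] with t ht i
    have h1 := hr i
    have h2 : 0 < t := ht
    simp
    linarith

theorem uniqueDiffOn_powerVectors (n : ℕ) : UniqueDiffOn ℝ (powerVectors n) := by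
  refine uniqueDiffOn_convex (convex_powerVectors n) ⟨WithLp.toLp 2 fun _ => 1, ?_⟩
  refine mem_interior.2 ⟨_, fun r hr i => (hr i).le, isOpen_posOrthant n, fun i => ?_⟩
  simp

/-- On an open convex set a derivative with a limit at a boundary point extends to the closure. The
limit exists because the coefficients `g i` are continuous. -/
theorem hasFDerivWithinAt_powerVectors {f : EuclideanSpace ℝ (Fin n) → ℝ}
    {g : Fin n → EuclideanSpace ℝ (Fin n) → ℝ} (hf : Continuous f) (hg : ∀ i, Continuous (g i))
    (h : ∀ r : EuclideanSpace ℝ (Fin n), (∀ i, 0 < r i) →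
      HasFDerivAt f (∑ i, g i r • (EuclideanSpace.proj i : _ →L[ℝ] ℝ)) r)
    (r : EuclideanSpace ℝ (Fin n)) :
    HasFDerivWithinAt f (∑ i, g i r • (EuclideanSpace.proj i : _ →L[ℝ] ℝ)) (powerVectors n) r := by
  rw [← closure_posOrthant]
  refine hasFDerivWithinAt_closure_of_tendsto_fderiv
    (fun x hx => (h x hx).differentiableAt.differentiableWithinAt) (convex_posOrthant n)
    (isOpen_posOrthant n) (fun y _ => hf.continuousWithinAt) ?_
  have hc : Continuous fun r : EuclideanSpace ℝ (Fin n) =>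
      ∑ i, g i r • (EuclideanSpace.proj i : EuclideanSpace ℝ (Fin n) →L[ℝ] ℝ) :=
    continuous_finsetSum _ fun i _ => (hg i).smul continuous_const
  refine ((hc.tendsto r).mono_left nhdsWithin_le_nhds).congr' ?_
  filter_upwards [self_mem_nhdsWithin] with x hx
  exact (h x hx).fderiv.symm

theorem hasFDerivWithinAt_gaussMean_entropyPotential (a : K → Fin n → ℂ)
    (r : EuclideanSpace ℝ (Fin n)) :
    HasFDerivWithinAt (gaussMean (entropyPotential (signalExponent a)))
      (∑ i, meanEnergy a i r • (EuclideanSpace.proj i : _ →L[ℝ] ℝ)) (powerVectors n) r :=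
  hasFDerivWithinAt_powerVectors (expGrowth_entropyPotential a).continuous_gaussMean
    (continuous_meanEnergy a) (fun _ hr => hasFDerivAt_gaussMean_entropyPotential a hr) r

theorem hasFDerivWithinAt_meanEnergy (a : K → Fin n → ℂ) (i : Fin n)
    (r : EuclideanSpace ℝ (Fin n)) :
    HasFDerivWithinAt (meanEnergy a i)
      (∑ j, meanSqCov a i j r • (EuclideanSpace.proj j : _ →L[ℝ] ℝ)) (powerVectors n) r := by
  refine hasFDerivWithinAt_powerVectors (continuous_meanEnergy a i) (continuous_meanSqCov a i)
    (fun r hr => ?_) r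
  refine (HasFDerivAt.fun_sum fun b _ => hasFDerivAt_gaussMean_gibbsEnergy a
    (fun k => coord (i, b) (a k)) hr).congr_fderiv ?_
  rw [Finset.sum_comm]
  exact Finset.sum_congr rfl fun j _ => by rw [meanSqCov, Finset.sum_smul]

theorem meanSqCov_eq (a : K → Fin n → ℂ) (i j : Fin n) (r : EuclideanSpace ℝ (Fin n)) :
    meanSqCov a i j r = gaussMean (fun w => 2 * partitionSum (signalExponent a) w *
      ∑ b, ∑ b', gibbsCov (signalExponent a) (fun k => coord (i, b) (a k))
        (fun k => coord (j, b') (a k)) w ^ 2) r := by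
  unfold meanSqCov
  rw [← gaussMean_sum _ fun b _ => expGrowth_sqCov a _ j]
  simp only [Finset.mul_sum]

theorem meanSqCov_comm (a : K → Fin n → ℂ) (i j : Fin n) (r : EuclideanSpace ℝ (Fin n)) :
    meanSqCov a i j r = meanSqCov a j i r := by
  rw [meanSqCov_eq, meanSqCov_eq]
  congr 1
  funext w
  rw [Finset.sum_comm]
  simp only [gibbsCov_comm (signalExponent a) (fun k => coord (i, _) (a k))]

theorem sum_mul_meanSqCov_nonneg (a : K → Fin n → ℂ) (v : Fin n → ℝ)
    (r : EuclideanSpace ℝ (Fin n)) : 0 ≤ ∑ i, ∑ j, v i * v j * meanSqCov a i j r := by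
  have hG : ∀ i j, ExpGrowth fun w => v i * v j * (2 * partitionSum (signalExponent a) w *
      ∑ b, ∑ b', gibbsCov (signalExponent a) (fun k => coord (i, b) (a k))
        (fun k => coord (j, b') (a k)) w ^ 2) := fun i j =>
    (((expGrowth_partitionSum _).const_mul 2).mul (ExpGrowth.sum _ fun _ _ =>
      ExpGrowth.sum _ fun _ _ => (expGrowth_gibbsCov _ _ _).pow 2)).const_mul _
  have h : ∑ i, ∑ j, v i * v j * meanSqCov a i j r = gaussMean (fun w => ∑ i, ∑ j, v i * v j *
      (2 * partitionSum (signalExponent a) w * ∑ b, ∑ b', gibbsCov (signalExponent a)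
        (fun k => coord (i, b) (a k)) (fun k => coord (j, b') (a k)) w ^ 2)) r := by
    rw [gaussMean_sum _ fun i _ => ExpGrowth.sum _ fun j _ => hG i j]
    refine Finset.sum_congr rfl fun i _ => ?_
    rw [gaussMean_sum _ fun j _ => hG i j]
    refine Finset.sum_congr rfl fun j _ => ?_
    rw [meanSqCov_eq]
    exact (integral_const_mul _ _).symm
  rw [h]
  refine integral_nonneg fun z => ?_
  -- Positivity is used on the `2n` real coordinates, with weights depending only on the complex
  -- index; grouping real and imaginary parts gives the double sum over `b`, `b'`.
  have hnn := sum_mul_gibbsCov_sq_nonneg (signalExponent a)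
    (fun (κ : Fin n × Bool) k => coord κ (a k)) (fun κ => v κ.1) (r, scaleNoise r z)
  have hQ := partitionSum_pos (signalExponent a) (r, scaleNoise r z)
  refine (mul_nonneg (mul_nonneg zero_le_two hQ.le) hnn).trans_eq ?_
  simp only [Fintype.sum_prod_type, Fintype.sum_bool, Finset.mul_sum, ← Finset.sum_add_distrib]
  refine Finset.sum_congr rfl fun i _ => Finset.sum_congr rfl fun j _ => ?_
  ring

end Signals

/-! ### Gradient, Hessian and concavity on the orthant -/

section Orthant

variable {n : ℕ} {f : EuclideanSpace ℝ (Fin n) → ℝ} {g : Fin n → EuclideanSpace ℝ (Fin n) → ℝ}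
  {h : Fin n → Fin n → EuclideanSpace ℝ (Fin n) → ℝ}

theorem hasGradientWithinAt_of_partials {s : Set (EuclideanSpace ℝ (Fin n))}
    {x : EuclideanSpace ℝ (Fin n)} {c : Fin n → ℝ}
    (hf : HasFDerivWithinAt f (∑ i, c i • (EuclideanSpace.proj i : _ →L[ℝ] ℝ)) s x) :
    HasGradientWithinAt f (WithLp.toLp 2 c) s x := by
  rw [hasGradientWithinAt_iff_hasFDerivWithinAt]
  refine hf.congr_fderiv ?_
  ext v
  simp [PiLp.inner_apply, mul_comm]

theorem hasHessianWithinAt_of_partials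
    (hf : ∀ r ∈ powerVectors n, HasFDerivWithinAt f
      (∑ i, g i r • (EuclideanSpace.proj i : _ →L[ℝ] ℝ)) (powerVectors n) r)
    (hg : ∀ i, ∀ r ∈ powerVectors n, HasFDerivWithinAt (g i)
      (∑ j, h i j r • (EuclideanSpace.proj j : _ →L[ℝ] ℝ)) (powerVectors n) r)
    {r : EuclideanSpace ℝ (Fin n)} (hr : r ∈ powerVectors n) :
    HasHessianWithinAt f (Matrix.of fun i j => h i j r) (powerVectors n) r := by
  -- Derivatives within the orthant are unique, so `gradientWithin` is the vector of the `g i` on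
  -- the walls too.
  have hgrad : ∀ x ∈ powerVectors n,
      gradientWithin f (powerVectors n) x = WithLp.toLp 2 fun i => g i x := by
    intro x hx
    have h1 := hasGradientWithinAt_of_partials (hf x hx)
    rw [hasGradientWithinAt_iff_hasFDerivWithinAt] at h1
    rw [gradientWithin, h1.fderivWithin (uniqueDiffOn_powerVectors n x hx),
      LinearIsometryEquiv.symm_apply_apply]
  unfold HasHessianWithinAt
  refine HasFDerivWithinAt.congr ?_ hgrad (hgrad r hr)
  rw [hasFDerivWithinAt_euclidean]
  intro i
  refine (hg i r hr).congr_fderiv ?_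
  ext v
  simp [Matrix.mulVec, dotProduct, Matrix.ofLp_toEuclideanCLM]

theorem posSemidef_neg_of_partials {r : EuclideanSpace ℝ (Fin n)}
    (hsymm : ∀ i j, h i j r = h j i r)
    (hneg : ∀ v : Fin n → ℝ, ∑ i, ∑ j, v i * v j * h i j r ≤ 0) :
    (-(Matrix.of fun i j => h i j r)).PosSemidef := by
  refine .of_dotProduct_mulVec_nonneg ?_ fun v => ?_
  · ext i j
    simp [hsymm i j]
  · have := hneg v
    have e : star v ⬝ᵥ (-(Matrix.of fun i j => h i j r)).mulVec v =
        -∑ i, ∑ j, v i * v j * h i j r := by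
      simp only [dotProduct, Matrix.mulVec, Matrix.neg_apply, Matrix.of_apply, Finset.mul_sum,
        ← Finset.sum_neg_distrib, Pi.star_apply, star_trivial]
      exact Finset.sum_congr rfl fun i _ => Finset.sum_congr rfl fun j _ => by ring
    rw [e]
    linarith

/-- Second-derivative test along a segment. The segment may lie in a wall, but derivatives within
the orthant pull back to it and are two-sided at its interior points. -/
theorem concaveOn_of_partials
    (hf : ∀ r ∈ powerVectors n, HasFDerivWithinAt f
      (∑ i, g i r • (EuclideanSpace.proj i : _ →L[ℝ] ℝ)) (powerVectors n) r)
    (hg : ∀ i, ∀ r ∈ powerVectors n, HasFDerivWithinAt (g i)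
      (∑ j, h i j r • (EuclideanSpace.proj j : _ →L[ℝ] ℝ)) (powerVectors n) r)
    (hneg : ∀ (v : Fin n → ℝ), ∀ r ∈ powerVectors n, ∑ i, ∑ j, v i * v j * h i j r ≤ 0) :
    ConcaveOn ℝ (powerVectors n) f := by
  refine ⟨convex_powerVectors n, fun x hx y hy s t hs ht hst => ?_⟩
  set p : ℝ → EuclideanSpace ℝ (Fin n) := fun τ => x + τ • (y - x) with hp
  have hpm : Set.MapsTo p (Set.Icc 0 1) (powerVectors n) := by
    intro τ hτ
    have := convex_powerVectors n hx hy (sub_nonneg.2 hτ.2) hτ.1 (by ring)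
    convert! this using 1
    simp only [hp, smul_sub, sub_smul, one_smul]
    abel
  have hpd : ∀ τ, HasDerivWithinAt p (y - x) (Set.Icc 0 1) τ := fun τ => by
    have := ((hasDerivAt_id τ).smul_const (y - x)).const_add x
    exact this.hasDerivWithinAt.congr_deriv (one_smul _ _)
  have hline : ∀ {F : EuclideanSpace ℝ (Fin n) → ℝ} {G : Fin n → EuclideanSpace ℝ (Fin n) → ℝ},
      (∀ r ∈ powerVectors n, HasFDerivWithinAt F
        (∑ i, G i r • (EuclideanSpace.proj i : _ →L[ℝ] ℝ)) (powerVectors n) r) →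
      ∀ τ ∈ Set.Icc (0 : ℝ) 1, HasDerivWithinAt (F ∘ p)
        (∑ i, G i (p τ) * (y i - x i)) (Set.Icc 0 1) τ := by
    intro F G hF τ hτ
    have := (hF (p τ) (hpm hτ)).comp_hasDerivWithinAt τ (hpd τ) hpm
    simpa using this
  have hconc : ConcaveOn ℝ (Set.Icc 0 1) (f ∘ p) := by
    have hint : interior (Set.Icc (0 : ℝ) 1) = Set.Ioo 0 1 := interior_Icc
    have hd1 : ∀ τ ∈ Set.Ioo (0 : ℝ) 1,
        HasDerivAt (f ∘ p) (∑ i, g i (p τ) * (y i - x i)) τ := fun τ hτ =>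
      (hline hf τ (Set.Ioo_subset_Icc_self hτ)).hasDerivAt (Icc_mem_nhds hτ.1 hτ.2)
    refine AntitoneOn.concaveOn_of_deriv (convex_Icc 0 1)
      (fun τ hτ => (hline hf τ hτ).continuousWithinAt) ?_ ?_
    · rw [hint]
      exact fun τ hτ => (hd1 τ hτ).differentiableAt.differentiableWithinAt
    · rw [hint]
      have hd2 : ∀ τ ∈ Set.Ioo (0 : ℝ) 1, HasDerivAt (fun τ => ∑ i, g i (p τ) * (y i - x i))
          (∑ i, (∑ j, h i j (p τ) * (y j - x j)) * (y i - x i)) τ := fun τ hτ =>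
        HasDerivAt.fun_sum fun i _ => (((hline (hg i) τ (Set.Ioo_subset_Icc_self hτ)).hasDerivAt
          (Icc_mem_nhds hτ.1 hτ.2)).mul_const _)
      have hanti : AntitoneOn (fun τ => ∑ i, g i (p τ) * (y i - x i)) (Set.Ioo (0 : ℝ) 1) := by
        refine antitoneOn_of_deriv_nonpos (convex_Ioo 0 1)
          (fun τ hτ => (hd2 τ hτ).continuousAt.continuousWithinAt) ?_ ?_
        · rw [interior_Ioo]
          exact fun τ hτ => (hd2 τ hτ).differentiableAt.differentiableWithinAt
        · rw [interior_Ioo]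
          intro τ hτ
          rw [(hd2 τ hτ).deriv]
          refine le_trans (le_of_eq ?_) (hneg (fun i => y i - x i) (p τ)
            (hpm (Set.Ioo_subset_Icc_self hτ)))
          refine Finset.sum_congr rfl fun i _ => ?_
          rw [Finset.sum_mul]
          exact Finset.sum_congr rfl fun j _ => by ring
      exact hanti.congr fun τ hτ => (hd1 τ hτ).deriv.symm
  have := hconc.2 (Set.left_mem_Icc.2 zero_le_one) (Set.right_mem_Icc.2 zero_le_one) hs ht hst
  have e : x + t • (y - x) = s • x + t • y := by
    have : s = 1 - t := by linarith
    rw [this, sub_smul, one_smul, smul_sub]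
    abel
  simpa [hp, e] using this

end Orthant

/-! ### The mutual information -/

section Channel

variable {n M : ℕ}

theorem mutualInfo_unitary_mul (c : Fin M → ℂ) {U : Matrix (Fin n) (Fin n) ℂ}
    (hU : U ∈ Matrix.unitaryGroup (Fin n) ℂ) (G : Matrix (Fin n) (Fin n) ℂ) :
    mutualInfo c (U * G) = mutualInfo c G := by
  unfold mutualInfo
  congr 2
  refine Finset.sum_congr rfl fun m _ => ?_
  rw [← integral_complexNoise_comp_unitary hU]
  simp only [← Matrix.mulVec_mulVec, ← Matrix.mulVec_add, sqNorm_mulVec_unitary hU]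

theorem likelihood_unitary_mul (c : Fin M → ℂ) {U : Matrix (Fin n) (Fin n) ℂ}
    (hU : U ∈ Matrix.unitaryGroup (Fin n) ℂ) (G : Matrix (Fin n) (Fin n) ℂ) (y : Fin n → ℂ)
    (m : Fin n → Fin M) : likelihood c (U * G) (U.mulVec y) m = likelihood c G y m := by
  simp only [likelihood, ← Matrix.mulVec_mulVec, ← Matrix.mulVec_sub, sqNorm_mulVec_unitary hU]

theorem mmseMatrix_unitary_mul (c : Fin M → ℂ) {U : Matrix (Fin n) (Fin n) ℂ}
    (hU : U ∈ Matrix.unitaryGroup (Fin n) ℂ) (G : Matrix (Fin n) (Fin n) ℂ) :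
    mmseMatrix c (U * G) = mmseMatrix c G := by
  unfold mmseMatrix
  congr 3
  ext i j
  rw [← integral_comp_unitary hU]
  simp only [likelihood_unitary_mul c hU]

/-- Undoing the shift leaves the mean of `2 Re ⟨b, z⟩ + ‖b‖²`, whose linear part is odd. -/
theorem integral_exp_mul_exponent {b : Fin n → ℂ} :
    ∫ z, Real.exp (-sqNorm (z - b) + sqNorm z) * (-sqNorm (z - b) + sqNorm z) ∂complexNoise n =
      sqNorm b := by
  rw [← integral_complexNoise_shift b fun z => -sqNorm (z - b) + sqNorm z]
  simp only [add_sub_cancel_right]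
  set l : (Fin n → ℂ) →L[ℝ] ℝ := ∑ κ, (2 * coord κ b) • coord κ with hl
  have h1 : ∀ z, -sqNorm z + sqNorm (z + b) = l z + sqNorm b := by
    intro z
    simp only [hl, sqNorm_eq_sum_coord, sum_apply, smul_apply, smul_eq_mul,
      ← Finset.sum_neg_distrib, ← Finset.sum_add_distrib, map_add]
    exact Finset.sum_congr rfl fun κ _ => by ring
  have hint : Integrable (fun z => l z) (complexNoise n) := by
    obtain ⟨C, -, hC⟩ := (ExpGrowth.clm l).exists_pos_bound
    exact ((integrable_exp_mul_norm n C).const_mul C).mono' l.continuous.aestronglyMeasurable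
      (.of_forall hC)
  have hc : Integrable (fun _ : Fin n → ℂ => sqNorm b) (complexNoise n) := by
    have := (integrable_exp_mul_norm n 0).const_mul (sqNorm b)
    simpa using this
  simp only [h1]
  rw [integral_add hint hc, integral_complexNoise_odd _ fun z => map_neg l z,
    integral_const_complexNoise, zero_add]

/-- Shifting the noise by the `m`-th signal brings all the integrals to the pure noise law, with
weight `exp (e m)`, and turns the logarithm into `log Q - e m`. The weights sum to `Q`, giving `Q
log Q`; the subtracted part is evaluated by `integral_exp_mul_exponent`. -/
theorem sum_integral_log_eq {K : Type*} [Fintype K] [Nonempty K] (a : K → Fin n → ℂ)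
    {r : EuclideanSpace ℝ (Fin n)} (hr : r ∈ powerVectors n) :
    ∑ m, ∫ z, Real.log (∑ k, Real.exp
      (-sqNorm (scaleNoise r (a m) - scaleNoise r (a k) + z) + sqNorm z)) ∂complexNoise n =
      gaussMean (entropyPotential (signalExponent a)) r - ∑ i, r i * ∑ m, ‖a m i‖ ^ 2 := by
  set Q : (Fin n → ℂ) → ℝ := fun z => partitionSum (signalExponent a) (r, scaleNoise r z) with hQ
  set e : K → (Fin n → ℂ) → ℝ := fun k z => signalExponent a k (r, scaleNoise r z) with he
  have he' : ∀ k z, e k z = -sqNorm (z - scaleNoise r (a k)) + sqNorm z := fun k z =>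
    signalExponent_scaleNoise a k hr z
  have hlog : ∀ m z, Real.log (∑ k, Real.exp
      (-sqNorm (z - scaleNoise r (a k)) + sqNorm (z - scaleNoise r (a m)))) =
      Real.log (Q z) - e m z := by
    intro m z
    have h1 : ∑ k, Real.exp (-sqNorm (z - scaleNoise r (a k)) + sqNorm (z - scaleNoise r (a m))) =
        Q z / Real.exp (e m z) := by
      simp only [hQ, partitionSum, Finset.sum_div]
      refine Finset.sum_congr rfl fun k _ => ?_
      have := he' k z
      simp only [he] at this
      rw [this, ← Real.exp_sub, he' m z]
      congr 1
      ring
    rw [h1, Real.log_div (partitionSum_pos _ _).ne' (Real.exp_pos _).ne', Real.log_exp]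
  have hterm : ∀ m, ∫ z, Real.log (∑ k, Real.exp
      (-sqNorm (scaleNoise r (a m) - scaleNoise r (a k) + z) + sqNorm z)) ∂complexNoise n =
      ∫ z, Real.exp (e m z) * Real.log (Q z) ∂complexNoise n -
        ∑ i, r i * ‖a m i‖ ^ 2 := by
    intro m
    have h1 : ∀ z, Real.log (∑ k, Real.exp
        (-sqNorm (scaleNoise r (a m) - scaleNoise r (a k) + z) + sqNorm z)) =
        (fun z => Real.log (Q z) - e m z) (z + scaleNoise r (a m)) := by
      intro z
      simp only [← hlog]
      congr 1
      refine Finset.sum_congr rfl fun k _ => ?_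
      congr 3
      · congr 1
        abel
      · abel
    simp only [h1]
    rw [integral_complexNoise_shift (scaleNoise r (a m)) fun z => Real.log (Q z) - e m z]
    simp only [← he', mul_sub]
    have hE := ExpGrowth.exp_clm (signalExponent a m)
    rw [integral_sub ((hE.mul (expGrowth_log_partitionSum _)).integrable_scaleNoise r)
      ((hE.mul (ExpGrowth.clm (signalExponent a m))).integrable_scaleNoise r)]
    congr 1
    have h2 := integral_exp_mul_exponent (b := scaleNoise r (a m))
    simp only [← he', sqNorm_scaleNoise hr] at h2
    exact h2
  simp only [hterm, Finset.sum_sub_distrib]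
  congr 1
  · rw [← integral_finsetSum]
    · simp only [gaussMean, entropyPotential, partitionSum, Finset.sum_mul, hQ, he]
    · intro m _
      exact ((ExpGrowth.exp_clm (signalExponent a m)).mul
        (expGrowth_log_partitionSum _)).integrable_scaleNoise r
  · rw [Finset.sum_comm]
    simp only [Finset.mul_sum]

theorem mutualInfo_eq [NeZero M] (c : Fin M → ℂ) (G : Matrix (Fin n) (Fin n) ℂ)
    (a : (Fin n → Fin M) → Fin n → ℂ) {r : EuclideanSpace ℝ (Fin n)} (hr : r ∈ powerVectors n)
    (hG : ∀ m, G.mulVec (signal c m) = scaleNoise r (a m)) :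
    mutualInfo c G = Real.logb 2 M - 1 / ((n : ℝ) * (M : ℝ) ^ n * Real.log 2) *
      (gaussMean (entropyPotential (signalExponent a)) r - ∑ i, r i * ∑ m, ‖a m i‖ ^ 2) := by
  rw [← sum_integral_log_eq a hr, mutualInfo]
  simp only [Real.logb, Matrix.mulVec_sub, hG, integral_div, ← Finset.sum_div]
  congr 1
  ring

end Channel

/-! ### The MMSE matrix in terms of mean energies. -/

section MMSE

variable {n M : ℕ}

theorem likelihood_pos (c : Fin M → ℂ) (G : Matrix (Fin n) (Fin n) ℂ) (y : Fin n → ℂ)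
    (m : Fin n → Fin M) : 0 < likelihood c G y m := Real.exp_pos _

theorem continuous_likelihood (c : Fin M → ℂ) (G : Matrix (Fin n) (Fin n) ℂ)
    (m : Fin n → Fin M) : Continuous fun y => likelihood c G y m := by
  unfold likelihood
  exact Real.continuous_exp.comp ((continuous_sqNorm n).comp (by fun_prop)).neg

theorem integrable_likelihood (c : Fin M → ℂ) (G : Matrix (Fin n) (Fin n) ℂ)
    (m : Fin n → Fin M) : Integrable fun y => likelihood c G y m := by
  have h := (integrable_exp_neg_mul_sqNorm n one_pos).comp_sub_right (G.mulVec (signal c m))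
  simpa [likelihood] using h

/-- The posterior correlation integrand
`[∑ₗ fₗ exp (-‖y - G xₗ‖²)] [∑ₖ gₖ exp (-‖y - G xₖ‖²)] / ∑ₘ exp (-‖y - G xₘ‖²)`. -/
noncomputable def posteriorProduct (c : Fin M → ℂ) (G : Matrix (Fin n) (Fin n) ℂ)
    (f g : (Fin n → Fin M) → ℂ) (y : Fin n → ℂ) : ℂ :=
  (∑ l, f l * (likelihood c G y l : ℂ)) * (∑ k, g k * (likelihood c G y k : ℂ)) /
    (∑ m, (likelihood c G y m : ℂ))

theorem sum_likelihood_pos [NeZero M] (c : Fin M → ℂ) (G : Matrix (Fin n) (Fin n) ℂ)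
    (y : Fin n → ℂ) : 0 < ∑ m, likelihood c G y m :=
  Finset.sum_pos (fun _ _ => likelihood_pos c G y _) Finset.univ_nonempty

theorem norm_sum_mul_likelihood_le (c : Fin M → ℂ) (G : Matrix (Fin n) (Fin n) ℂ)
    (f : (Fin n → Fin M) → ℂ) (y : Fin n → ℂ) :
    ‖∑ l, f l * (likelihood c G y l : ℂ)‖ ≤ ∑ l, ‖f l‖ * likelihood c G y l := by
  refine (norm_sum_le _ _).trans_eq (Finset.sum_congr rfl fun l _ => ?_)
  rw [norm_mul, Complex.norm_real, Real.norm_of_nonneg (likelihood_pos c G y l).le]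

/-- The second factor over the denominator is a weighted average, bounded by `∑ ‖g k‖`; the first is
a finite sum of Gaussians. -/
theorem integrable_posteriorProduct [NeZero M] (c : Fin M → ℂ) (G : Matrix (Fin n) (Fin n) ℂ)
    (f g : (Fin n → Fin M) → ℂ) : Integrable (posteriorProduct c G f g) := by
  have hcont : ∀ l, Continuous fun y => (likelihood c G y l : ℂ) := fun l =>
    Complex.continuous_ofReal.comp (continuous_likelihood c G l)
  have hD : ∀ y, ∑ m, (likelihood c G y m : ℂ) = ((∑ m, likelihood c G y m : ℝ) : ℂ) := fun y => by
    push_cast; rfl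
  refine ((integrable_finsetSum Finset.univ fun l _ =>
    (integrable_likelihood c G l).const_mul ‖f l‖).mul_const (∑ k, ‖g k‖)).mono' ?_
    (.of_forall fun y => ?_)
  · refine Continuous.aestronglyMeasurable (Continuous.div ?_ ?_ fun y => ?_)
    · exact (continuous_finsetSum _ fun l _ => continuous_const.mul (hcont l)).mul
        (continuous_finsetSum _ fun l _ => continuous_const.mul (hcont l))
    · exact continuous_finsetSum _ fun l _ => hcont l
    · rw [hD]
      exact_mod_cast (sum_likelihood_pos c G y).ne'
  · have hpos := sum_likelihood_pos c G y
    rw [posteriorProduct, hD, norm_div, norm_mul, Complex.norm_real, Real.norm_of_nonneg hpos.le,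
      mul_div_assoc]
    refine mul_le_mul (norm_sum_mul_likelihood_le c G f y) ?_ (by positivity)
      (Finset.sum_nonneg fun l _ => mul_nonneg (norm_nonneg _) (likelihood_pos c G y l).le)
    rw [div_le_iff₀ hpos, Finset.sum_mul]
    refine (norm_sum_mul_likelihood_le c G g y).trans (Finset.sum_le_sum fun k _ => ?_)
    exact mul_le_mul_of_nonneg_left (Finset.single_le_sum (f := fun m => likelihood c G y m)
      (fun m _ => (likelihood_pos c G y m).le) (Finset.mem_univ k)) (norm_nonneg _)

theorem mul_mmseMatrix_mul_apply [NeZero M] (c : Fin M → ℂ) (G V : Matrix (Fin n) (Fin n) ℂ)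
    (hV : V ∈ Matrix.unitaryGroup (Fin n) ℂ) (i : Fin n) :
    (V * mmseMatrix c G * V.conjTranspose) i i =
      1 - (1 : ℂ) / ((Real.pi : ℂ) * (M : ℂ)) ^ n *
        ∫ y, posteriorProduct c G (fun m => V.mulVec (signal c m) i)
          (fun m => star (V.mulVec (signal c m) i)) y := by
  have hVV : V * V.conjTranspose = 1 := by
    rw [← Matrix.star_eq_conjTranspose]
    exact Matrix.mem_unitaryGroup_iff.1 hV
  have hprod : ∀ y, posteriorProduct c G (fun m => V.mulVec (signal c m) i)
      (fun m => star (V.mulVec (signal c m) i)) y =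
      ∑ q, (∑ p, V i p * posteriorProduct c G (fun m => signal c m p)
        (fun m => star (signal c m q)) y) * star (V i q) := by
    intro y
    have h1 : ∑ l, V.mulVec (signal c l) i * (likelihood c G y l : ℂ) =
        ∑ p, V i p * ∑ l, signal c l p * (likelihood c G y l : ℂ) := by
      simp only [Matrix.mulVec, dotProduct, Finset.sum_mul, Finset.mul_sum]
      rw [Finset.sum_comm]
      simp only [mul_assoc]
    have h2 : ∑ l, star (V.mulVec (signal c l) i) * (likelihood c G y l : ℂ) =
        ∑ q, star (V i q) * ∑ l, star (signal c l q) * (likelihood c G y l : ℂ) := by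
      simp only [Matrix.mulVec, dotProduct, star_sum, star_mul', Finset.sum_mul, Finset.mul_sum]
      rw [Finset.sum_comm]
      simp only [mul_assoc]
    simp only [posteriorProduct]
    rw [h1, h2, Finset.sum_mul_sum, Finset.sum_comm, Finset.sum_div]
    refine Finset.sum_congr rfl fun q _ => ?_
    rw [Finset.sum_div, Finset.sum_mul]
    exact Finset.sum_congr rfl fun p _ => by ring
  have hint : ∀ p q, Integrable (posteriorProduct c G (fun m => signal c m p)
      (fun m => star (signal c m q))) := fun p q => integrable_posteriorProduct c G _ _
  have hX : (V * (Matrix.of fun p q => ∫ y, posteriorProduct c G (fun m => signal c m p)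
      (fun m => star (signal c m q)) y) * V.conjTranspose) i i =
      ∫ y, posteriorProduct c G (fun m => V.mulVec (signal c m) i)
        (fun m => star (V.mulVec (signal c m) i)) y := by
    simp only [hprod]
    rw [integral_finsetSum _ fun q _ =>
      (integrable_finsetSum _ fun p _ => (hint p q).const_mul (V i p)).mul_const _]
    simp only [Matrix.mul_apply, Matrix.of_apply, Matrix.conjTranspose_apply]
    refine Finset.sum_congr rfl fun q _ => ?_
    rw [integral_mul_const, integral_finsetSum _ fun p _ => (hint p q).const_mul (V i p)]
    simp only [integral_const_mul]
  rw [← hX]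
  have hE : mmseMatrix c G = 1 - ((1 : ℂ) / ((Real.pi : ℂ) * (M : ℂ)) ^ n) •
      Matrix.of fun p q => ∫ y, posteriorProduct c G (fun m => signal c m p)
        (fun m => star (signal c m q)) y := rfl
  rw [hE, Matrix.mul_sub, Matrix.sub_mul, Matrix.mul_one, hVV, Matrix.mul_smul, Matrix.smul_mul]
  simp

/-- Each likelihood is `exp (-‖y‖²)` times the likelihood ratio. One such factor survives the
quotient and is `π ^ n` times the noise density; the numerators multiply to `(X + iY)(X - iY) = X² +
Y²`, the sum of the two energies. -/
theorem posteriorProduct_star_eq [NeZero M] (c : Fin M → ℂ) (G : Matrix (Fin n) (Fin n) ℂ)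
    (a : (Fin n → Fin M) → Fin n → ℂ) {r : EuclideanSpace ℝ (Fin n)} (hr : r ∈ powerVectors n)
    (hG : ∀ m, G.mulVec (signal c m) = scaleNoise r (a m)) (i : Fin n) (y : Fin n → ℂ) :
    posteriorProduct c G (fun m => a m i) (fun m => star (a m i)) y =
      ((Real.pi ^ n * (noiseDensity y * ∑ b, gibbsEnergy (signalExponent a)
        (fun k => coord (i, b) (a k)) (r, scaleNoise r y)) : ℝ) : ℂ) := by
  set w := (r, scaleNoise r y)
  have hl : ∀ m, likelihood c G y m =
      Real.exp (-sqNorm y) * Real.exp (signalExponent a m w) := by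
    intro m
    rw [signalExponent_scaleNoise a m hr, likelihood, hG, ← Real.exp_add]
    congr 1
    ring
  set X := expSum (signalExponent a) (fun k => coord (i, true) (a k)) w with hX
  set Y := expSum (signalExponent a) (fun k => coord (i, false) (a k)) w with hY
  have h1 : ∑ l, a l i * (likelihood c G y l : ℂ) =
      (Real.exp (-sqNorm y) : ℂ) * (X + Y * Complex.I) := by
    have : ∀ l, a l i * (likelihood c G y l : ℂ) = (Real.exp (-sqNorm y) : ℂ) *
        ((coord (i, true) (a l) * Real.exp (signalExponent a l w) : ℝ) +
          (coord (i, false) (a l) * Real.exp (signalExponent a l w) : ℝ) * Complex.I) := by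
      intro l
      rw [hl, coord_true, coord_false]
      conv_lhs => rw [← Complex.re_add_im (a l i)]
      push_cast
      ring
    simp only [this, ← Finset.mul_sum, Finset.sum_add_distrib, ← Finset.sum_mul, hX, hY, expSum]
    push_cast
    rfl
  have h2 : ∑ l, star (a l i) * (likelihood c G y l : ℂ) =
      (Real.exp (-sqNorm y) : ℂ) * (X - Y * Complex.I) := by
    have h3 := congrArg (starRingEnd ℂ) h1
    simpa [sub_eq_add_neg, ← Complex.exp_conj] using h3
  have h3 : ∑ m, (likelihood c G y m : ℂ) =
      (Real.exp (-sqNorm y) : ℂ) * (partitionSum (signalExponent a) w : ℂ) := by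
    simp only [hl, partitionSum]
    push_cast
    rw [Finset.mul_sum]
  have hQ : (partitionSum (signalExponent a) w : ℂ) ≠ 0 := by
    exact_mod_cast (partitionSum_pos (signalExponent a) w).ne'
  have hexp : (Real.exp (-sqNorm y) : ℂ) ≠ 0 := by exact_mod_cast (Real.exp_pos _).ne'
  have hpi : (Real.pi : ℂ) ^ n ≠ 0 := pow_ne_zero _ (by exact_mod_cast Real.pi_ne_zero)
  rw [posteriorProduct, h1, h2, h3]
  simp only [Fintype.sum_bool, gibbsEnergy, gibbsMean, ← hX, ← hY, noiseDensity, Complex.ofReal_mul,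
    Complex.ofReal_add, Complex.ofReal_div, Complex.ofReal_pow]
  field_simp
  linear_combination -((Y : ℂ) ^ 2) * Complex.I_sq

theorem integral_posteriorProduct_star [NeZero M] (c : Fin M → ℂ) (G : Matrix (Fin n) (Fin n) ℂ)
    (a : (Fin n → Fin M) → Fin n → ℂ) {r : EuclideanSpace ℝ (Fin n)} (hr : r ∈ powerVectors n)
    (hG : ∀ m, G.mulVec (signal c m) = scaleNoise r (a m)) (i : Fin n) :
    ∫ y, posteriorProduct c G (fun m => a m i) (fun m => star (a m i)) y =
      ((Real.pi ^ n * meanEnergy a i r : ℝ) : ℂ) := by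
  simp only [posteriorProduct_star_eq c G a hr hG i]
  rw [integral_complex_ofReal, integral_const_mul, meanEnergy,
    ← gaussMean_sum _ fun b _ => expGrowth_gibbsEnergy _ _, gaussMean, integral_complexNoise]
  rfl

theorem sq_mul_mmseMatrix_apply [NeZero M] (c : Fin M → ℂ) (G V : Matrix (Fin n) (Fin n) ℂ)
    (hV : V ∈ Matrix.unitaryGroup (Fin n) ℂ) (σ : Fin n → ℝ) {r : EuclideanSpace ℝ (Fin n)}
    (hr : r ∈ powerVectors n)
    (hG : ∀ m, G.mulVec (signal c m) = scaleNoise r ((Diag σ * V).mulVec (signal c m)))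
    (i : Fin n) :
    (Diag σ ^ 2 * V * mmseMatrix c G * V.conjTranspose) i i =
      ((σ i ^ 2 - 1 / (M : ℝ) ^ n *
        meanEnergy (fun m => (Diag σ * V).mulVec (signal c m)) i r : ℝ) : ℂ) := by
  have h1 : Diag σ ^ 2 * V * mmseMatrix c G * V.conjTranspose =
      Matrix.diagonal (fun i => (σ i : ℂ) ^ 2) * (V * mmseMatrix c G * V.conjTranspose) := by
    rw [Diag, Matrix.diagonal_pow]
    simp only [Matrix.mul_assoc]
    rfl
  have h2 : ∀ m, (Diag σ * V).mulVec (signal c m) i = σ i * V.mulVec (signal c m) i := by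
    intro m
    rw [← Matrix.mulVec_mulVec, Diag, Matrix.mulVec_diagonal]
  have h3 := integral_posteriorProduct_star c G (fun m => (Diag σ * V).mulVec (signal c m)) hr hG i
  have h4 : ∀ y, posteriorProduct c G (fun m => (Diag σ * V).mulVec (signal c m) i)
      (fun m => star ((Diag σ * V).mulVec (signal c m) i)) y = (σ i : ℂ) ^ 2 *
      posteriorProduct c G (fun m => V.mulVec (signal c m) i)
        (fun m => star (V.mulVec (signal c m) i)) y := by
    intro y
    simp only [posteriorProduct, h2, star_mul', Complex.star_def, Complex.conj_ofReal, mul_assoc,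
      ← Finset.mul_sum]
    ring
  simp only [h4] at h3
  rw [integral_const_mul] at h3
  rw [h1, Matrix.diagonal_mul, mul_mmseMatrix_mul_apply c G V hV i]
  have hM : (M : ℂ) ^ n ≠ 0 := pow_ne_zero _ (by exact_mod_cast NeZero.ne M)
  have hpi : (Real.pi : ℂ) ^ n ≠ 0 := pow_ne_zero _ (by exact_mod_cast Real.pi_ne_zero)
  rw [mul_sub, mul_left_comm, h3, mul_pow]
  push_cast
  field_simp

/-- Unit covariance is invariant under conjugation by `V`; this is its `i`-th diagonal entry. -/
theorem sum_norm_sq_mulVec_signal (c : Fin M → ℂ) (hcov : HasUnitCovariance n c)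
    (hM : M ≠ 0) (V : Matrix (Fin n) (Fin n) ℂ) (hV : V ∈ Matrix.unitaryGroup (Fin n) ℂ)
    (i : Fin n) : ∑ m : Fin n → Fin M, ‖V.mulVec (signal c m) i‖ ^ 2 = (M : ℝ) ^ n := by
  have hM' : (M : ℂ) ^ n ≠ 0 := pow_ne_zero _ (by exact_mod_cast hM)
  have h1 : ∑ m : Fin n → Fin M, Matrix.vecMulVec (signal c m) (star (signal c m)) =
      ((M : ℂ) ^ n) • (1 : Matrix (Fin n) (Fin n) ℂ) := by
    rw [← hcov, smul_smul, mul_one_div_cancel hM', one_smul]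
  have h2 := congrArg (fun X => (V * X * V.conjTranspose) i i) h1
  have hVV : V * V.conjTranspose = 1 := by
    rw [← Matrix.star_eq_conjTranspose]
    exact Matrix.mem_unitaryGroup_iff.1 hV
  simp only [Matrix.mul_sum, Matrix.sum_mul, Matrix.mul_smul, Matrix.smul_mul, hVV,
    Matrix.sum_apply, Matrix.mul_vecMulVec, Matrix.vecMulVec_mul, ← Matrix.star_mulVec,
    Matrix.vecMulVec_apply, Matrix.smul_apply, Matrix.one_apply_eq, Pi.star_apply,
    Complex.star_def, Complex.mul_conj', smul_eq_mul, mul_one] at h2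
  exact_mod_cast h2

end MMSE

/-! ### Derivatives of the mutual information in the powers. -/

section PowerAllocation

variable {n M : ℕ}

/-- The diagonal factors commute, so the powers enter only as a scaling by `√λ` of the fixed vectors
`Diag σ * V x`, up to a unitary on the output side. -/
theorem channel_mul_precoder {H UH VH V : Matrix (Fin n) (Fin n) ℂ} {σ : Fin n → ℝ}
    (hVH : VH ∈ Matrix.unitaryGroup (Fin n) ℂ) (hH : H = UH * Diag σ * VH.conjTranspose)
    (lam : Fin n → ℝ) :
    H * precoder VH V lam = UH * (Diag (fun i => Real.sqrt (lam i)) * (Diag σ * V)) := by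
  have h1 : VH.conjTranspose * VH = 1 := by
    rw [← Matrix.star_eq_conjTranspose]
    exact Matrix.mem_unitaryGroup_iff'.1 hVH
  have h2 : Diag σ * Diag (fun i => Real.sqrt (lam i)) =
      Diag (fun i => Real.sqrt (lam i)) * Diag σ := by
    simp only [Diag, Matrix.diagonal_mul_diagonal, mul_comm]
  calc H * precoder VH V lam = UH * Diag σ * (VH.conjTranspose * VH) *
        (Diag (fun i => Real.sqrt (lam i)) * V) := by
        rw [hH, precoder]; simp only [Matrix.mul_assoc]
    _ = UH * (Diag σ * Diag (fun i => Real.sqrt (lam i)) * V) := by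
        rw [h1, Matrix.mul_one]; simp only [Matrix.mul_assoc]
    _ = _ := by rw [h2]; simp only [Matrix.mul_assoc]

theorem diag_sqrt_mulVec (A : Matrix (Fin n) (Fin n) ℂ) (r : EuclideanSpace ℝ (Fin n))
    (x : Fin n → ℂ) :
    (Diag (fun i => Real.sqrt (r i)) * A).mulVec x = scaleNoise r (A.mulVec x) := by
  ext i
  rw [← Matrix.mulVec_mulVec, Diag, Matrix.mulVec_diagonal, scaleNoise]

theorem reductionMatrix_mulVec_vec (A : Matrix (Fin n) (Fin n) ℂ) (i : Fin n) :
    ((reductionMatrix n).map Complex.ofReal).mulVec (Matrix.vec A) i = A i i := by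
  simp only [Matrix.mulVec, dotProduct, Fintype.sum_prod_type, Matrix.map_apply, reductionMatrix,
    Matrix.of_apply, Matrix.vec]
  rw [Finset.sum_eq_single i, Finset.sum_eq_single i]
  · simp
  · intro k _ hk
    simp [hk.symm]
  · simp
  · intro j _ hj
    simp [hj.symm]
  · simp

/-- The scale of the derivatives of the mutual information. -/
noncomputable def infoScale (n M : ℕ) : ℝ := 1 / ((n : ℝ) * (M : ℝ) ^ n * Real.log 2)

theorem infoScale_nonneg (n M : ℕ) : 0 ≤ infoScale n M := by
  have := Real.log_pos one_lt_two
  unfold infoScale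
  positivity

/-- The partial derivatives of the mutual information in the powers. -/
noncomputable def infoGrad (c : Fin M → ℂ) (A : Matrix (Fin n) (Fin n) ℂ) (i : Fin n)
    (r : EuclideanSpace ℝ (Fin n)) : ℝ :=
  infoScale n M * (∑ m, ‖A.mulVec (signal c m) i‖ ^ 2 -
    meanEnergy (fun m => A.mulVec (signal c m)) i r)

/-- The second partial derivatives of the mutual information in the powers. -/
noncomputable def infoHess (c : Fin M → ℂ) (A : Matrix (Fin n) (Fin n) ℂ) (i j : Fin n)
    (r : EuclideanSpace ℝ (Fin n)) : ℝ :=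
  -(infoScale n M * meanSqCov (fun m => A.mulVec (signal c m)) i j r)

theorem hasFDerivWithinAt_powerMutualInfo [NeZero M] (c : Fin M → ℂ)
    {H UH VH V : Matrix (Fin n) (Fin n) ℂ} {σ : Fin n → ℝ}
    (hUH : UH ∈ Matrix.unitaryGroup (Fin n) ℂ) (hVH : VH ∈ Matrix.unitaryGroup (Fin n) ℂ)
    (hH : H = UH * Diag σ * VH.conjTranspose)
    {r : EuclideanSpace ℝ (Fin n)} (hr : r ∈ powerVectors n) :
    HasFDerivWithinAt (powerMutualInfo c H VH V)
      (∑ i, infoGrad c (Diag σ * V) i r • (EuclideanSpace.proj i : _ →L[ℝ] ℝ))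
      (powerVectors n) r := by
  have heq : ∀ x ∈ powerVectors n, powerMutualInfo c H VH V x = Real.logb 2 M - infoScale n M *
      (gaussMean (entropyPotential (signalExponent fun m => (Diag σ * V).mulVec (signal c m))) x -
        ∑ i, x i * ∑ m, ‖(Diag σ * V).mulVec (signal c m) i‖ ^ 2) := by
    intro x hx
    rw [powerMutualInfo, channel_mul_precoder hVH hH, mutualInfo_unitary_mul c hUH]
    exact mutualInfo_eq c _ _ hx fun m => diag_sqrt_mulVec _ _ _
  refine HasFDerivWithinAt.congr ?_ heq (heq r hr)
  have h1 := hasFDerivWithinAt_gaussMean_entropyPotential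
    (fun m => (Diag σ * V).mulVec (signal c m)) r
  have h2 : HasFDerivWithinAt (fun x : EuclideanSpace ℝ (Fin n) =>
      ∑ i, x i * ∑ m, ‖(Diag σ * V).mulVec (signal c m) i‖ ^ 2)
      (∑ i, (∑ m, ‖(Diag σ * V).mulVec (signal c m) i‖ ^ 2) •
        (EuclideanSpace.proj i : EuclideanSpace ℝ (Fin n) →L[ℝ] ℝ)) (powerVectors n) r :=
    HasFDerivWithinAt.fun_sum fun i _ => ((EuclideanSpace.proj i :
      EuclideanSpace ℝ (Fin n) →L[ℝ] ℝ).hasFDerivAt.mul_const _).hasFDerivWithinAt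
  refine (((h1.sub h2).const_mul (infoScale n M)).const_sub (Real.logb 2 M)).congr_fderiv ?_
  ext v
  simp only [infoGrad, neg_apply, smul_apply, sub_apply, sum_apply, smul_eq_mul, ← Finset.sum_sub_distrib,
    Finset.mul_sum, ← Finset.sum_neg_distrib]
  exact Finset.sum_congr rfl fun i _ => by ring

theorem hasFDerivWithinAt_infoGrad [NeZero M] (c : Fin M → ℂ) (A : Matrix (Fin n) (Fin n) ℂ)
    (i : Fin n) (r : EuclideanSpace ℝ (Fin n)) :
    HasFDerivWithinAt (infoGrad c A i)
      (∑ j, infoHess c A i j r • (EuclideanSpace.proj j : _ →L[ℝ] ℝ)) (powerVectors n) r := by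
  refine (((hasFDerivWithinAt_meanEnergy (fun m => A.mulVec (signal c m)) i r).const_sub
    (∑ m, ‖A.mulVec (signal c m) i‖ ^ 2)).const_mul (infoScale n M)).congr_fderiv ?_
  simp only [infoHess, smul_neg, Finset.smul_sum, smul_smul, neg_smul, Finset.sum_neg_distrib]

theorem infoHess_comm [NeZero M] (c : Fin M → ℂ) (A : Matrix (Fin n) (Fin n) ℂ) (i j : Fin n)
    (r : EuclideanSpace ℝ (Fin n)) : infoHess c A i j r = infoHess c A j i r := by
  rw [infoHess, infoHess, meanSqCov_comm]

theorem sum_mul_infoHess_nonpos [NeZero M] (c : Fin M → ℂ) (A : Matrix (Fin n) (Fin n) ℂ)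
    (v : Fin n → ℝ) (r : EuclideanSpace ℝ (Fin n)) :
    ∑ i, ∑ j, v i * v j * infoHess c A i j r ≤ 0 := by
  have h1 := mul_nonneg (infoScale_nonneg n M)
    (sum_mul_meanSqCov_nonneg (fun m => A.mulVec (signal c m)) v r)
  have h2 : ∑ i, ∑ j, v i * v j * infoHess c A i j r = -(infoScale n M *
      ∑ i, ∑ j, v i * v j * meanSqCov (fun m => A.mulVec (signal c m)) i j r) := by
    simp only [infoHess, Finset.mul_sum, ← Finset.sum_neg_distrib]
    exact Finset.sum_congr rfl fun i _ => Finset.sum_congr rfl fun j _ => by ring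
  rw [h2]
  linarith

/-- For an empty constellation and `n ≠ 0` there are no signal vectors, so the covariance would be
zero. -/
theorem HasUnitCovariance.constellation_ne_zero (hn : n ≠ 0) {c : Fin M → ℂ}
    (hcov : HasUnitCovariance n c) : M ≠ 0 := by
  rintro rfl
  have hn' : Nonempty (Fin n) := ⟨⟨0, Nat.pos_of_ne_zero hn⟩⟩
  obtain ⟨i⟩ := hn'
  have : IsEmpty (Fin n → Fin 0) := ⟨fun m => (m i).elim0⟩
  have h := congrFun (congrFun hcov i) i
  simp at h

/-- Unit covariance evaluates the linear part as `σ i ^ 2 * M ^ n`, so the factor `M ^ n` cancels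
and the difference is the diagonal entry computed in `sq_mul_mmseMatrix_apply`. -/
theorem infoGrad_eq_mmse [NeZero M] {c : Fin M → ℂ} (hcov : HasUnitCovariance n c)
    {H UH VH V : Matrix (Fin n) (Fin n) ℂ} {σ : Fin n → ℝ}
    (hUH : UH ∈ Matrix.unitaryGroup (Fin n) ℂ) (hVH : VH ∈ Matrix.unitaryGroup (Fin n) ℂ)
    (hH : H = UH * Diag σ * VH.conjTranspose) (hV : V ∈ Matrix.unitaryGroup (Fin n) ℂ)
    {lam : EuclideanSpace ℝ (Fin n)} (hlam : lam ∈ powerVectors n) (i : Fin n) :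
    (infoGrad c (Diag σ * V) i lam : ℂ) = ((1 / ((n : ℝ) * Real.log 2) : ℝ) : ℂ) *
      (Diag σ ^ 2 * V * mmseMatrix c (H * precoder VH V lam) * V.conjTranspose) i i := by
  have hM : M ≠ 0 := NeZero.ne M
  have hsum : ∑ m, ‖(Diag σ * V).mulVec (signal c m) i‖ ^ 2 = σ i ^ 2 * (M : ℝ) ^ n := by
    rw [← sum_norm_sq_mulVec_signal c hcov hM V hV i, Finset.mul_sum]
    refine Finset.sum_congr rfl fun m _ => ?_
    rw [← Matrix.mulVec_mulVec, Diag, Matrix.mulVec_diagonal, norm_mul, mul_pow,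
      Complex.norm_real, Real.norm_eq_abs, sq_abs]
  rw [channel_mul_precoder hVH hH, mmseMatrix_unitary_mul c hUH,
    sq_mul_mmseMatrix_apply c _ V hV σ hlam (fun m => diag_sqrt_mulVec _ _ _) i,
    ← Complex.ofReal_mul]
  congr 1
  have hM' : (M : ℝ) ^ n ≠ 0 := pow_ne_zero _ (by exact_mod_cast hM)
  have hn : (n : ℝ) ≠ 0 := by exact_mod_cast i.pos.ne'
  have hlog : Real.log 2 ≠ 0 := (Real.log_pos one_lt_two).ne'
  rw [infoGrad, hsum, infoScale]
  field_simp

end PowerAllocation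

/-! ### Concavity, gradient and Hessian for `n = 2L`. -/

theorem proposition4 (L M : ℕ) (hL : 1 ≤ L)
    (c : Fin M → ℂ) (hinj : Function.Injective c) (hcov : HasUnitCovariance (2 * L) c)
    (H UH VH V : Matrix (Fin (2 * L)) (Fin (2 * L)) ℂ) (σ : Fin (2 * L) → ℝ)
    (hUH : UH ∈ Matrix.unitaryGroup (Fin (2 * L)) ℂ)
    (hVH : VH ∈ Matrix.unitaryGroup (Fin (2 * L)) ℂ)
    (hσ : ∀ i, 0 ≤ σ i) (hσ' : Antitone σ)
    (hH : H = UH * Diag σ * VH.conjTranspose)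
    (hV : V ∈ Matrix.unitaryGroup (Fin (2 * L)) ℂ) :
    ConcaveOn ℝ (powerVectors (2 * L)) (powerMutualInfo c H VH V) ∧
    (∀ lam ∈ powerVectors (2 * L), ∃ g : EuclideanSpace ℝ (Fin (2 * L)),
      HasGradientWithinAt (powerMutualInfo c H VH V) g (powerVectors (2 * L)) lam ∧
      (fun i => (g i : ℂ)) =
        ((1 / (2 * (L : ℝ) * Real.log 2) : ℝ) : ℂ) •
          ((reductionMatrix (2 * L)).map Complex.ofReal).mulVec
            (Matrix.vec (Diag σ ^ 2 * V * mmseMatrix c (H * precoder VH V lam) *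
              V.conjTranspose))) ∧
    (∀ lam ∈ powerVectors (2 * L), ∃ A : Matrix (Fin (2 * L)) (Fin (2 * L)) ℝ,
      HasHessianWithinAt (powerMutualInfo c H VH V) A (powerVectors (2 * L)) lam ∧ (-A).PosSemidef) := by
  have : NeZero M := ⟨hcov.constellation_ne_zero (by omega)⟩
  have hf := fun r (hr : r ∈ powerVectors (2 * L)) =>
    hasFDerivWithinAt_powerMutualInfo c (V := V) hUH hVH hH hr
  have hg := fun i r (_ : r ∈ powerVectors (2 * L)) =>
    hasFDerivWithinAt_infoGrad c (Diag σ * V) i r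
  refine ⟨concaveOn_of_partials hf hg fun v r _ => sum_mul_infoHess_nonpos c _ v r,
    fun lam hlam => ⟨_, hasGradientWithinAt_of_partials (hf lam hlam), ?_⟩,
    fun lam hlam => ⟨_, hasHessianWithinAt_of_partials hf hg hlam, posSemidef_neg_of_partials
      (fun i j => infoHess_comm c _ i j lam) fun v => sum_mul_infoHess_nonpos c _ v lam⟩⟩
  funext i
  rw [Pi.smul_apply, reductionMatrix_mulVec_vec, smul_eq_mul]
  refine (infoGrad_eq_mmse hcov hUH hVH hH hV hlam i).trans ?_
  push_cast
  rfl
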